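/- Let $G$ be a compact connected (real, finite-dimensional, smooth) Lie group with Lie algebra $\mathfrak g$, and let $\cdot$ be an inner product on $\mathfrak g$ invariant under the adjoint action. Let $\theta,\bar\theta\in\Omega^1(G)\otimes\mathfrak g$ be the left- and right-invariant Maurer–Cartan forms, and put $$\lambda=\tfrac16\,\theta\cdot[\theta,\theta]\in\Omega^3(G),\qquad \Omega=\pi_1^*\theta\cdot\pi_2^*\bar\theta\in\Omega^2(G\times G),$$ where $\pi_1,\pi_2:G\times G\to G$ are the projections and, for 1-forms, products are normalised by $(\alpha\cdot\beta)(X,Y)=\alpha(X)\cdot\beta(Y)-\alpha(Y)\cdot\beta(X)$ and $[\theta,\theta](X,Y)=2[\theta(X),\theta(Y)]$ (and $d$ is normalised so that $d\alpha(X,Y)=X\alpha(Y)-Y\alpha(X)-\alpha([X,Y])$). Let $g\ge 0$ be an integer, let $\mathbb F$ be the free group on $x_1,\dots,x_{2g}$, let $R=\prod_{i=1}^g[x_{2i-1},x_{2i}]$ with $[a,b]=aba^{-1}b^{-1}$, and let $$c=\sum_{i=1}^{2g}\Bigl(\frac{\partial R}{\partial x_i},x_i\Bigr)\in C_2(\mathbb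 F)=\mathbb Z[\mathbb F\times\mathbb F],$$ where $\partial/\partial x_i:\mathbb F\to\mathbb Z[\mathbb F]$ is the Fox derivative ($\partial x_j/\partial x_i=\delta_{ij}$, $\partial(uv)/\partial x_i=\partial u/\partial x_i+u\,\partial v/\partial x_i$) and $(\sum_u n_u u,x)$ means $\sum_u n_u(u,x)$. Identify $\mathrm{Hom}(\mathbb F,G)$ with $G^{2g}$ through the images of the generators. For $u,v\in\mathbb F$ let $E_{(u,v)}:\mathrm{Hom}(\mathbb F,G)\to G\times G$, $h\mapsto(h(u),h(v))$, and let $$\omega=\langle c,E^*\Omega\rangle=\sum_{(u,v)}c_{(u,v)}\,E_{(u,v)}^*\Omega,\qquad c=\sum_{(u,v)} c_{(u,v)}\,(u,v).$$ Let $\epsilon_R:\mathrm{Hom}(\mathbb F,G)=G^{2g}\to G$, $h\mapsto h(R)$, be evaluation on $R$. Then $\epsilon_R(g_1,\dots,g_{2g})=\prod_{i=1}^g[g_{2i-1},g_{2i}]$, $\omega$ is a smooth 2-form on $G^{2g}$, and $$d\omega=-\epsilon_R^*\lambda .$$ -/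

import Mathlib

open scoped Manifold ContDiff

noncomputable section

namespace SurfaceForm

/-! ### Tangent spaces of finite-dimensional manifolds -/

section Tangent

variable {E : Type*} [NormedAddCommGroup E] [NormedSpace ℝ E]
  {H : Type*} [TopologicalSpace H] (I : ModelWithCorners ℝ E H)
  {M : Type*} [TopologicalSpace M] [ChartedSpace H M]

instance instT2SpaceTangentSpace (x : M) : T2Space (TangentSpace I x) :=
  inferInstanceAs (T2Space E)

instance instFiniteDimensionalTangentSpace [FiniteDimensional ℝ E] (x : M) :
    FiniteDimensional ℝ (TangentSpace I x) :=
  inferInstanceAs (FiniteDimensional ℝ E)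

end Tangent

/-! ### Wedge product of a vector-valued 1-form with a vector-valued form -/

section Wedge

variable {T V W Z : Type*}
  [AddCommGroup T] [Module ℝ T] [TopologicalSpace T]
  [AddCommGroup V] [Module ℝ V] [TopologicalSpace V] [IsTopologicalAddGroup V]
  [ContinuousSMul ℝ V] [T2Space V] [FiniteDimensional ℝ V]
  [AddCommGroup W] [Module ℝ W] [TopologicalSpace W] [IsTopologicalAddGroup W]
  [ContinuousSMul ℝ W] [T2Space W] [FiniteDimensional ℝ W]
  [AddCommGroup Z] [Module ℝ Z] [TopologicalSpace Z] [IsTopologicalAddGroup Z]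
  [ContinuousSMul ℝ Z]

/-- A bilinear map between finite-dimensional spaces is jointly continuous. -/
theorem continuous_bilin (b : V →ₗ[ℝ] W →ₗ[ℝ] Z) :
    Continuous fun p : V × W => b p.1 p.2 := by
  have h : (fun p : V × W => b p.1 p.2) = fun p : V × W =>
      ∑ i, (Module.finBasis ℝ V).coord i p.1 • b (Module.finBasis ℝ V i) p.2 := by
    funext p
    have hp := (Module.finBasis ℝ V).sum_repr p.1
    conv_lhs => rw [← hp]
    rw [map_sum, LinearMap.sum_apply]
    refine Finset.sum_congr rfl fun i _ => ?_
    rw [map_smul, LinearMap.smul_apply, Module.Basis.coord_apply]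
  rw [h]
  refine continuous_finsetSum _ fun i _ => Continuous.smul ?_ ?_
  · exact (LinearMap.continuous_of_finiteDimensional _).comp continuous_fst
  · exact (LinearMap.continuous_of_finiteDimensional _).comp continuous_snd

/-- The linear map sending `x` to the alternating map `v ↦ b (α x) (β v)`. -/
def wedgeAux {n : ℕ} (b : V →ₗ[ℝ] W →ₗ[ℝ] Z) (α : T [⋀^Fin 1]→L[ℝ] V)
    (β : T [⋀^Fin n]→L[ℝ] W) : T →ₗ[ℝ] T [⋀^Fin n]→ₗ[ℝ] Z where
  toFun x := (b (α fun _ => x)).compAlternatingMap β.toAlternatingMap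
  map_add' x y := by
    have h : α (fun _ => x + y) = α (fun _ => x) + α (fun _ => y) :=
      ((ContinuousAlternatingMap.ofSubsingleton ℝ T V (0 : Fin 1)).symm α).map_add x y
    ext v
    simp [h]
  map_smul' c x := by
    have h : α (fun _ => c • x) = c • α (fun _ => x) :=
      ((ContinuousAlternatingMap.ofSubsingleton ℝ T V (0 : Fin 1)).symm α).map_smul c x
    ext v
    simp [h]

/-- The wedge product `α ∧ β` of a `V`-valued 1-form and a `W`-valued `n`-form with respect to
a bilinear pairing `b : V × W → Z`, in the normalisation where, for two 1-forms,
`(α ∧ β)(x, y) = b (α x) (β y) - b (α y) (β x)`. -/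
def wedge {n : ℕ} (b : V →ₗ[ℝ] W →ₗ[ℝ] Z) (α : T [⋀^Fin 1]→L[ℝ] V)
    (β : T [⋀^Fin n]→L[ℝ] W) : T [⋀^Fin (n + 1)]→L[ℝ] Z where
  __ := (AlternatingMap.alternatizeUncurryFin (wedgeAux b α β) : T [⋀^Fin (n + 1)]→ₗ[ℝ] Z)
  cont := by
    change Continuous fun v : Fin (n + 1) → T =>
      AlternatingMap.alternatizeUncurryFin (wedgeAux b α β) v
    simp only [AlternatingMap.alternatizeUncurryFin_apply]
    refine continuous_finsetSum _ fun i _ => ?_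
    have h1 : Continuous fun v : Fin (n + 1) → T => α fun _ => v i :=
      α.cont.comp (continuous_pi fun _ => continuous_apply i)
    have h2 : Continuous fun v : Fin (n + 1) → T => β (i.removeNth v) :=
      β.cont.comp (continuous_pi fun j => continuous_apply (i.succAbove j))
    exact ((continuous_bilin b).comp (h1.prodMk h2)).const_smul ((-1 : ℤ) ^ (i : ℕ))

theorem wedge_apply {n : ℕ} (b : V →ₗ[ℝ] W →ₗ[ℝ] Z) (α : T [⋀^Fin 1]→L[ℝ] V)
    (β : T [⋀^Fin n]→L[ℝ] W) (v : Fin (n + 1) → T) :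
    wedge b α β v =
      ∑ i : Fin (n + 1), (-1) ^ (i : ℕ) • b (α fun _ => v i) (β (i.removeNth v)) :=
  AlternatingMap.alternatizeUncurryFin_apply _ _

end Wedge

/-! ### Differential forms on manifolds -/

section Forms

variable {E : Type*} [NormedAddCommGroup E] [NormedSpace ℝ E]
  {H : Type*} [TopologicalSpace H] (I : ModelWithCorners ℝ E H)
  {E' : Type*} [NormedAddCommGroup E'] [NormedSpace ℝ E']
  {H' : Type*} [TopologicalSpace H'] (I' : ModelWithCorners ℝ E' H')
  (M : Type*) [TopologicalSpace M] [ChartedSpace H M]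
  {N : Type*} [TopologicalSpace N] [ChartedSpace H' N]

/-- Differential `k`-forms on `M` with values in `V`, as families of alternating maps on the
tangent spaces; smoothness is the separate predicate `IsSmoothForm`. -/
abbrev DForm (V : Type*) [AddCommGroup V] [Module ℝ V] [TopologicalSpace V] (k : ℕ) : Type _ :=
  ∀ x : M, TangentSpace I x [⋀^Fin k]→L[ℝ] V

variable {M}

/-- The pullback `f^* β` of a differential form. -/
def pullback {V : Type*} [AddCommGroup V] [Module ℝ V] [TopologicalSpace V] {k : ℕ}
    (f : M → N) (β : DForm I' N V k) : DForm I M V k :=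
  fun x => (β (f x)).compContinuousLinearMap (mfderiv I I' f x)

/-- The expression of a form in the chart at `x₀`: the pullback of the form under the inverse
of the extended chart, a form on (a subset of) the model vector space. -/
def localRep {k : ℕ} (β : DForm I M ℝ k) (x₀ : M) (y : E) : E [⋀^Fin k]→L[ℝ] ℝ :=
  (β ((extChartAt I x₀).symm y)).compContinuousLinearMap
    ((mfderivWithin 𝓘(ℝ, E) I (extChartAt I x₀).symm (Set.range I) y).comp
      ((NormedSpace.fromTangentSpace (𝕜 := ℝ) y).symm : E →L[ℝ] TangentSpace 𝓘(ℝ, E) y))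

/-- A form is smooth if its expression in every chart is smooth. -/
def IsSmoothForm {k : ℕ} (β : DForm I M ℝ k) : Prop :=
  ∀ x₀ : M, ContDiffOn ℝ ∞ (localRep I β x₀) (extChartAt I x₀).target

/-- The exterior derivative: at `x` it is the pullback under the chart at `x` of the exterior
derivative of the expression of the form in that chart. -/
def extDer {k : ℕ} (β : DForm I M ℝ k) : DForm I M ℝ (k + 1) :=
  fun x => (extDerivWithin (localRep I β x) (Set.range I)
      (extChartAt I x x)).compContinuousLinearMap
    ((NormedSpace.fromTangentSpace (𝕜 := ℝ) (extChartAt I x x) :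
        TangentSpace 𝓘(ℝ, E) (extChartAt I x x) →L[ℝ] E).comp
      (mfderiv I 𝓘(ℝ, E) (extChartAt I x) x))

end Forms

/-! ### Invariant forms on a Lie group -/

section LieGroup

variable {E : Type*} [NormedAddCommGroup E] [NormedSpace ℝ E]
  {H : Type*} [TopologicalSpace H] (I : ModelWithCorners ℝ E H)
  (G : Type*) [TopologicalSpace G] [ChartedSpace H G] [Group G]

/-- The left-invariant Maurer-Cartan form `θ`: at `a`, the derivative of `x ↦ a⁻¹ x`. -/
def leftMC : DForm I G (GroupLieAlgebra I G) 1 := fun a =>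
  let L : TangentSpace I a →L[ℝ] GroupLieAlgebra I G := mfderiv I I (fun x : G => a⁻¹ * x) a
  ContinuousAlternatingMap.ofSubsingleton ℝ _ _ 0 L

/-- The right-invariant Maurer-Cartan form: at `a`, the derivative of `x ↦ x a⁻¹`. -/
def rightMC : DForm I G (GroupLieAlgebra I G) 1 := fun a =>
  let R : TangentSpace I a →L[ℝ] GroupLieAlgebra I G := mfderiv I I (fun x : G => x * a⁻¹) a
  ContinuousAlternatingMap.ofSubsingleton ℝ _ _ 0 R

variable {G}

/-- The adjoint action of `a` on the Lie algebra: the derivative of `x ↦ a x a⁻¹` at `1`. -/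
def Ad (a : G) : GroupLieAlgebra I G →L[ℝ] GroupLieAlgebra I G :=
  mfderiv I I (fun x : G => a * x * a⁻¹) 1

/-- `B` is an inner product on the Lie algebra, invariant under the adjoint action. -/
structure IsInvariantInner (B : LinearMap.BilinForm ℝ (GroupLieAlgebra I G)) : Prop where
  symm : ∀ X Y, B X Y = B Y X
  pos : ∀ X, X ≠ 0 → 0 < B X X
  invariant : ∀ (a : G) (X Y), B (Ad I a X) (Ad I a Y) = B X Y

variable (G) [FiniteDimensional ℝ E]

/-- The form `Ω = π₁^* θ · π₂^* (right-invariant form)` on `G × G`. -/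
def Omega (B : LinearMap.BilinForm ℝ (GroupLieAlgebra I G)) : DForm (I.prod I) (G × G) ℝ 2 :=
  fun p => wedge B (pullback (I.prod I) I Prod.fst (leftMC I G) p)
    (pullback (I.prod I) I Prod.snd (rightMC I G) p)

variable [LieGroup I ∞ G]

/-- The Lie bracket of the Lie algebra of `G`, as a bilinear map. -/
def bracket : GroupLieAlgebra I G →ₗ[ℝ] GroupLieAlgebra I G →ₗ[ℝ] GroupLieAlgebra I G :=
  haveI : CompleteSpace E := FiniteDimensional.complete ℝ E
  haveI : LieGroup I (minSmoothness ℝ 3) G :=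
    LieGroup.of_le (n := ∞) (by rw [minSmoothness_of_isRCLikeNormedField]; exact ENat.LEInfty.out)
  LinearMap.mk₂ ℝ (fun X Y => ⁅X, Y⁆) add_lie smul_lie lie_add (fun c X Y => lie_smul c X Y)

/-- The form `λ = (1/6) θ · [θ, θ]` on `G`. -/
def lambdaForm (B : LinearMap.BilinForm ℝ (GroupLieAlgebra I G)) : DForm I G ℝ 3 :=
  fun a => (1 / 6 : ℝ) •
    wedge B (leftMC I G a) (wedge (bracket I G) (leftMC I G a) (leftMC I G a))

end LieGroup

/-! ### Fox calculus -/

section Fox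

variable {α : Type*} [DecidableEq α]

/-- The affine transformation `z ↦ x_j z + δ_{ij}` of the integral group ring of the free
group. -/
def foxAffine (i j : α) : Equiv.Perm (MonoidAlgebra ℤ (FreeGroup α)) where
  toFun z := MonoidAlgebra.of ℤ _ (FreeGroup.of j) * z + if j = i then 1 else 0
  invFun z := MonoidAlgebra.of ℤ _ (FreeGroup.of j)⁻¹ * (z - if j = i then 1 else 0)
  left_inv z := by
    beta_reduce
    rw [add_sub_cancel_right, ← mul_assoc, ← map_mul, inv_mul_cancel, map_one, one_mul]
  right_inv z := by
    beta_reduce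
    rw [← mul_assoc, ← map_mul, mul_inv_cancel, map_one, one_mul, sub_add_cancel]

/-- The Fox derivative `∂u/∂x_i` of an element `u` of the free group. The action of the free
group by the affine maps `z ↦ x_j z + δ_{ij}` is `z ↦ u z + ∂u/∂x_i`, so that the derivative is
the image of `0`; the characteristic properties are proved below. -/
def fox (i : α) (u : FreeGroup α) : MonoidAlgebra ℤ (FreeGroup α) :=
  FreeGroup.lift (foxAffine i) u 0

theorem lift_foxAffine_apply (i : α) (u : FreeGroup α) (z : MonoidAlgebra ℤ (FreeGroup α)) :
    FreeGroup.lift (foxAffine i) u z = MonoidAlgebra.of ℤ _ u * z + fox i u := by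
  suffices h : ∀ z w, FreeGroup.lift (foxAffine i) u z - FreeGroup.lift (foxAffine i) u w =
      MonoidAlgebra.of ℤ _ u * (z - w) by
    have := h z 0
    rw [sub_zero] at this
    rw [← this, fox, sub_add_cancel]
  induction u using FreeGroup.induction_on with
  | C1 => intro z w; rw [map_one, map_one, one_mul]; rfl
  | of j =>
    intro z w
    rw [FreeGroup.lift_apply_of]
    simp only [foxAffine, Equiv.coe_fn_mk]
    rw [mul_sub]; abel
  | inv_of j _ =>
    intro z w
    rw [map_inv, FreeGroup.lift_apply_of]
    change (foxAffine i j).symm z - (foxAffine i j).symm w = _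
    simp only [foxAffine, Equiv.coe_fn_symm_mk]
    rw [← mul_sub]; congr 1; abel
  | mul u v hu hv =>
    intro z w
    rw [map_mul, Equiv.Perm.mul_apply, Equiv.Perm.mul_apply, hu, hv, map_mul, mul_assoc]

/-- Fox derivatives of the generators. -/
theorem fox_of (i j : α) : fox i (FreeGroup.of j) = if j = i then 1 else 0 := by
  rw [fox, FreeGroup.lift_apply_of]
  simp only [foxAffine, Equiv.coe_fn_mk, mul_zero, zero_add]

/-- The product rule of the Fox calculus. -/
theorem fox_mul (i : α) (u v : FreeGroup α) :
    fox i (u * v) = fox i u + MonoidAlgebra.of ℤ _ u * fox i v := by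
  have h : fox i (u * v) = FreeGroup.lift (foxAffine i) u (fox i v) := by
    rw [fox, map_mul]; rfl
  rw [h, lift_foxAffine_apply, add_comm]

end Fox

/-! ### The surface relation, its 2-chain and the 2-form -/

/-- Group 2-chains: integral linear combinations of pairs of elements. -/
abbrev Chain2 (Γ : Type*) : Type _ := Γ × Γ →₀ ℤ

/-- The index of the generator `x_{2i-1}` (for `i = 1, …, g`, counted from zero in Lean). -/
def idxA {g : ℕ} (i : Fin g) : Fin (2 * g) := ⟨2 * i, by omega⟩

/-- The index of the generator `x_{2i}`. -/
def idxB {g : ℕ} (i : Fin g) : Fin (2 * g) := ⟨2 * i + 1, by omega⟩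

open scoped commutatorElement in
/-- The ordered product `[h₁, h₂] [h₃, h₄] ⋯ [h_{2g-1}, h_{2g}]` with
`[a, b] = a b a⁻¹ b⁻¹`. -/
def prodComm {Γ : Type*} [Group Γ] {g : ℕ} (h : Fin (2 * g) → Γ) : Γ :=
  (List.ofFn fun i : Fin g => ⁅h (idxA i), h (idxB i)⁆).prod

/-- The surface relation in the free group on `2g` generators. -/
def surfaceRel (g : ℕ) : FreeGroup (Fin (2 * g)) := prodComm FreeGroup.of

/-- The 2-chain `c = ∑ i, (∂R/∂x_i, x_i)`, where `(∑ n_u u, x)` stands for `∑ n_u (u, x)`. -/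
def foxChain (g : ℕ) : Chain2 (FreeGroup (Fin (2 * g))) :=
  ∑ i : Fin (2 * g),
    Finsupp.mapDomain (fun u => (u, FreeGroup.of i)) (fox i (surfaceRel g)).coeff

section Surface

variable {E : Type*} [NormedAddCommGroup E] [NormedSpace ℝ E]
  {H : Type*} [TopologicalSpace H] (I : ModelWithCorners ℝ E H)
  {G : Type*} [TopologicalSpace G] [ChartedSpace H G] [Group G]

/-- Evaluation at `u` on the homomorphisms from the free group on `n` generators to `G`,
identified with `G^n`. -/
def evalAt {n : ℕ} (u : FreeGroup (Fin n)) (h : Fin n → G) : G := FreeGroup.lift h u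

/-- The model with corners of `G^n`. -/
abbrev powModel (n : ℕ) : ModelWithCorners ℝ (Fin n → E) (ModelPi fun _ : Fin n => H) :=
  ModelWithCorners.pi fun _ : Fin n => I

/-- `E^* β` for a form `β` on `G × G`: the family of forms on `G^n` indexed by pairs `(u, v)`
of elements of the free group, given by pullback under `h ↦ (h u, h v)`. -/
def evalPullback {n k : ℕ} (β : DForm (I.prod I) (G × G) ℝ k)
    (p : FreeGroup (Fin n) × FreeGroup (Fin n)) : DForm (powModel I n) (Fin n → G) ℝ k :=
  pullback (powModel I n) (I.prod I) (fun h => (evalAt p.1 h, evalAt p.2 h)) β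

/-- The pairing of a 2-chain with a family indexed by pairs, extended linearly. -/
def pairing {Γ A : Type*} [AddCommGroup A] (c : Chain2 Γ) (φ : Γ × Γ → A) : A :=
  c.sum fun p m => m • φ p

variable [FiniteDimensional ℝ E]

/-- The 2-form `ω = ⟨c, E^* Ω⟩` on `G^{2g}`. -/
def omega (B : LinearMap.BilinForm ℝ (GroupLieAlgebra I G)) (g : ℕ) :
    DForm (powModel I (2 * g)) (Fin (2 * g) → G) ℝ 2 :=
  pairing (foxChain g) (evalPullback I (Omega I G B))

end Surface

end SurfaceForm

end

open scoped Manifold ContDiff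

noncomputable section

namespace SurfaceForm

open Filter Topology VectorField

section Chart

variable {E : Type*} [NormedAddCommGroup E] [NormedSpace ℝ E]
  {H : Type*} [TopologicalSpace H] (I : ModelWithCorners ℝ E H)
  {G : Type*} [TopologicalSpace G] [ChartedSpace H G] [Group G]
  {F : Type*} [NormedAddCommGroup F] [NormedSpace ℝ F]

/-- The preferred chart at the identity of a Lie group. -/
def idChart : G → E := extChartAt I (1 : G)

variable (G) in
/-- The inverse of the preferred chart at the identity of a Lie group. -/
def idChartSymm : E → G := (extChartAt I (1 : G)).symm

variable (G) in
/-- The coordinates of the identity of a Lie group. -/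
def idPt : E := idChart I (1 : G)

/-- The pullback of the left Maurer-Cartan form under a map from a vector space, in coordinates. -/
def leftLog (f : F → G) (y : F) : F →L[ℝ] E :=
  fderiv ℝ (fun z => idChart I ((f y)⁻¹ * f z)) y

/-- The pullback of the right Maurer-Cartan form under a map from a vector space, in
coordinates. -/
def rightLog (f : F → G) (y : F) : F →L[ℝ] E :=
  fderiv ℝ (fun z => idChart I (f z * (f y)⁻¹)) y

/-- The adjoint action in coordinates. -/
def adChart (a : G) : E →L[ℝ] E :=
  fderiv ℝ (fun b => idChart I (a * idChartSymm I G b * a⁻¹)) (idPt I G)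

theorem idChartSymm_idPt : idChartSymm I G (idPt I G) = 1 :=
  extChartAt_to_inv (I := I) (1 : G)

theorem eventually_idChartSymm_idChart :
    ∀ᶠ x in 𝓝 (1 : G), idChartSymm I G (idChart I x) = x := by
  filter_upwards [extChartAt_source_mem_nhds (I := I) (1 : G)] with x hx
  exact (extChartAt I (1 : G)).left_inv hx

theorem leftLog_const_mul (a : G) (f : F → G) : leftLog I (fun y => a * f y) = leftLog I f := by
  ext1 y
  simp only [leftLog, mul_inv_rev, mul_assoc, inv_mul_cancel_left]

section Boundaryless

variable [I.Boundaryless]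

theorem eventually_idChart_idChartSymm :
    ∀ᶠ a in 𝓝 (idPt I G), idChart I (idChartSymm I G a) = a := by
  filter_upwards [extChartAt_target_mem_nhds (I := I) (1 : G)] with x hx
  exact (extChartAt I (1 : G)).right_inv hx

variable [LieGroup I ∞ G]

omit [I.Boundaryless] [LieGroup I ∞ G] in
theorem contMDiffAt_idChart : ContMDiffAt I 𝓘(ℝ, E) ∞ (idChart I) (1 : G) :=
  contMDiffAt_extChartAt

theorem contMDiffAt_idChartSymm : ContMDiffAt 𝓘(ℝ, E) I ∞ (idChartSymm I G) (idPt I G) := by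
  have h := contMDiffOn_extChartAt_symm (I := I) (n := ∞) (1 : G)
  exact h.contMDiffAt (extChartAt_target_mem_nhds (I := I) (1 : G))

variable {I}

omit [I.Boundaryless] [LieGroup I ∞ G] in
theorem contDiffAt_idChart_comp {n : ℕ∞} {P : F → G} {y : F} (hP : ContMDiffAt 𝓘(ℝ, F) I n P y)
    (h1 : P y = 1) : ContDiffAt ℝ n (fun z => idChart I (P z)) y := by
  rw [← contMDiffAt_iff_contDiffAt]
  have : ContMDiffAt I 𝓘(ℝ, E) n (idChart I) (P y) := by
    rw [h1]; exact (contMDiffAt_idChart I).of_le (by exact_mod_cast le_top)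
  exact this.comp y hP

omit [I.Boundaryless] [LieGroup I ∞ G] in
theorem differentiableAt_idChart_comp {P : F → G} {y : F} (hP : ContMDiffAt 𝓘(ℝ, F) I 1 P y)
    (h1 : P y = 1) : DifferentiableAt ℝ (fun z => idChart I (P z)) y :=
  (contDiffAt_idChart_comp (n := 1) hP h1).differentiableAt one_ne_zero

/-- Chain rule in the chart at the identity, for maps fixing the identity. -/
theorem fderiv_idChart_comp {P : F → G} {y : F} (hP : ContMDiffAt 𝓘(ℝ, F) I 1 P y)
    (h1 : P y = 1) {φ : G → G} (hφ : ContMDiffAt I I 1 φ 1) (hφ1 : φ 1 = 1) :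
    fderiv ℝ (fun z => idChart I (φ (P z))) y =
      (fderiv ℝ (fun b => idChart I (φ (idChartSymm I G b))) (idPt I G)).comp
        (fderiv ℝ (fun z => idChart I (P z)) y) := by
  have hev : (fun z => idChart I (φ (P z))) =ᶠ[𝓝 y]
      (fun b => idChart I (φ (idChartSymm I G b))) ∘ (fun z => idChart I (P z)) := by
    have : Tendsto P (𝓝 y) (𝓝 1) := h1 ▸ hP.continuousAt
    filter_upwards [this.eventually (eventually_idChartSymm_idChart I)] with z hz
    simp [hz]
  have hy : idChart I (P y) = idPt I G := by rw [h1]; rfl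
  rw [hev.fderiv_eq, fderiv_comp _ _ (differentiableAt_idChart_comp hP h1), hy]
  rw [hy]
  refine differentiableAt_idChart_comp (P := fun b => φ (idChartSymm I G b)) ?_ ?_
  · refine ContMDiffAt.comp (I' := I) (g := φ) _ ?_ ((contMDiffAt_idChartSymm I).of_le ?_)
    · rwa [idChartSymm_idPt]
    · exact_mod_cast le_top
  · rw [idChartSymm_idPt, hφ1]

/-- The derivative of a product of two maps at a point where both take the value `1`. -/
theorem fderiv_idChart_mul {P Q : F → G} {y : F} (hP : ContMDiffAt 𝓘(ℝ, F) I 1 P y)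
    (hP1 : P y = 1) (hQ : ContMDiffAt 𝓘(ℝ, F) I 1 Q y) (hQ1 : Q y = 1) :
    fderiv ℝ (fun z => idChart I (P z * Q z)) y =
      fderiv ℝ (fun z => idChart I (P z)) y + fderiv ℝ (fun z => idChart I (Q z)) y := by
  set e := idPt I G
  let M : E × E → E := fun p => idChart I (idChartSymm I G p.1 * idChartSymm I G p.2)
  have hs := (contMDiffAt_idChartSymm (G := G) I).of_le (m := 1) (by exact_mod_cast le_top)
  have hM : DifferentiableAt ℝ M (e, e) := by
    refine differentiableAt_idChart_comp
      (P := fun p : E × E => idChartSymm I G p.1 * idChartSymm I G p.2) ?_ ?_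
    · have h1 : ContMDiffAt 𝓘(ℝ, E × E) 𝓘(ℝ, E) 1 (Prod.fst : E × E → E) (e, e) :=
        contDiff_fst.contMDiff.contMDiffAt
      have h2 : ContMDiffAt 𝓘(ℝ, E × E) 𝓘(ℝ, E) 1 (Prod.snd : E × E → E) (e, e) :=
        contDiff_snd.contMDiff.contMDiffAt
      exact (ContMDiffAt.comp (e, e) (g := idChartSymm I G) hs h1).mul
        (ContMDiffAt.comp (e, e) (g := idChartSymm I G) hs h2)
    · simp [e, idChartSymm_idPt]
  have hinl : (fderiv ℝ M (e, e)).comp (ContinuousLinearMap.inl ℝ E E) =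
      ContinuousLinearMap.id ℝ E := by
    have h1 : HasFDerivAt (fun a : E => (a, e)) (ContinuousLinearMap.inl ℝ E E) e :=
      hasFDerivAt_prodMk_left e e
    have h2 := HasFDerivAt.comp (g := M) (f := fun a : E => (a, e)) e hM.hasFDerivAt h1
    refine h2.unique ((hasFDerivAt_id e).congr_of_eventuallyEq ?_)
    filter_upwards [eventually_idChart_idChartSymm (G := G) I] with a ha
    simp [M, e, idChartSymm_idPt, ha]
  have hinr : (fderiv ℝ M (e, e)).comp (ContinuousLinearMap.inr ℝ E E) =
      ContinuousLinearMap.id ℝ E := by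
    have h1 : HasFDerivAt (fun a : E => (e, a)) (ContinuousLinearMap.inr ℝ E E) e :=
      hasFDerivAt_prodMk_right e e
    have h2 := HasFDerivAt.comp (g := M) (f := fun a : E => (e, a)) e hM.hasFDerivAt h1
    refine h2.unique ((hasFDerivAt_id e).congr_of_eventuallyEq ?_)
    filter_upwards [eventually_idChart_idChartSymm (G := G) I] with a ha
    simp [M, e, idChartSymm_idPt, ha]
  have hev : (fun z => idChart I (P z * Q z)) =ᶠ[𝓝 y]
      M ∘ (fun z => (idChart I (P z), idChart I (Q z))) := by
    have hP' : Tendsto P (𝓝 y) (𝓝 1) := hP1 ▸ hP.continuousAt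
    have hQ' : Tendsto Q (𝓝 y) (𝓝 1) := hQ1 ▸ hQ.continuousAt
    filter_upwards [hP'.eventually (eventually_idChartSymm_idChart I),
      hQ'.eventually (eventually_idChartSymm_idChart I)] with z hz hz'
    simp [M, hz, hz']
  have dP := differentiableAt_idChart_comp hP hP1
  have dQ := differentiableAt_idChart_comp hQ hQ1
  have hy : (idChart I (P y), idChart I (Q y)) = (e, e) := by rw [hP1, hQ1]; rfl
  rw [hev.fderiv_eq, fderiv_comp _ (by rw [hy]; exact hM) (dP.prodMk dQ), hy,
    DifferentiableAt.fderiv_prodMk dP dQ]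
  ext v
  have h1 := DFunLike.congr_fun hinl (fderiv ℝ (fun z => idChart I (P z)) y v)
  have h2 := DFunLike.congr_fun hinr (fderiv ℝ (fun z => idChart I (Q z)) y v)
  simp only [ContinuousLinearMap.comp_apply, ContinuousLinearMap.inl_apply,
    ContinuousLinearMap.inr_apply, ContinuousLinearMap.id_apply] at h1 h2
  simp only [ContinuousLinearMap.comp_apply, ContinuousLinearMap.prod_apply,
    add_apply]
  nth_rw 2 [← h1]
  nth_rw 2 [← h2]
  rw [← map_add]
  simp

variable {f h : F → G} {y : F}

omit [I.Boundaryless] in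
theorem contMDiffAt_conj (a : G) {n : ℕ∞} {x : G} :
    ContMDiffAt I I n (fun x : G => a * x * a⁻¹) x :=
  haveI : LieGroup I n G := LieGroup.of_le (n := ∞) (by exact_mod_cast le_top)
  ((contMDiffAt_const (c := a)).mul contMDiffAt_id).mul contMDiffAt_const

/-- The conjugate of a map with value `1` at a point. -/
theorem fderiv_idChart_conj (a : G) {P : F → G} (hP : ContMDiffAt 𝓘(ℝ, F) I 1 P y)
    (h1 : P y = 1) :
    fderiv ℝ (fun z => idChart I (a * P z * a⁻¹)) y =
      (adChart I a).comp (fderiv ℝ (fun z => idChart I (P z)) y) :=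
  fderiv_idChart_comp hP h1 (φ := fun x => a * x * a⁻¹) (contMDiffAt_conj a (n := 1)) (by simp)

theorem rightLog_eq (hf : ContMDiffAt 𝓘(ℝ, F) I 1 f y) :
    rightLog I f y = (adChart I (f y)).comp (leftLog I f y) := by
  have c : ContMDiffAt 𝓘(ℝ, F) I 1 (fun z => (f y)⁻¹ * f z) y := contMDiffAt_const.mul hf
  rw [leftLog, ← fderiv_idChart_conj (f y) c (by simp), rightLog]
  simp

theorem rightLog_eq_neg (hf : ContMDiffAt 𝓘(ℝ, F) I 1 f y) :
    rightLog I f y = - leftLog I (fun z => (f z)⁻¹) y := by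
  have : LieGroup I 1 G := inferInstance
  have h := fderiv_idChart_mul (P := fun z => f z * (f y)⁻¹) (Q := fun z => f y * (f z)⁻¹) (y := y)
    (hf.mul contMDiffAt_const) (by simp) (contMDiffAt_const.mul hf.inv) (by simp)
  rw [eq_neg_iff_add_eq_zero, rightLog, leftLog]
  simp only [inv_inv]
  rw [← h]
  simp

theorem leftLog_mul (hf : ContMDiffAt 𝓘(ℝ, F) I 1 f y) (hh : ContMDiffAt 𝓘(ℝ, F) I 1 h y) :
    leftLog I (fun z => f z * h z) y =
      (adChart I (h y)⁻¹).comp (leftLog I f y + rightLog I h y) := by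
  have : LieGroup I 1 G := inferInstance
  have c1 : ContMDiffAt 𝓘(ℝ, F) I 1 (fun z => (f y)⁻¹ * f z) y := contMDiffAt_const.mul hf
  have c2 : ContMDiffAt 𝓘(ℝ, F) I 1 (fun z => h z * (h y)⁻¹) y := hh.mul contMDiffAt_const
  have c3 : ContMDiffAt 𝓘(ℝ, F) I 1 (fun z => (f y)⁻¹ * f z * (h z * (h y)⁻¹)) y := c1.mul c2
  have e1 : leftLog I f y + rightLog I h y = _ :=
    (fderiv_idChart_mul c1 (by simp) c2 (by simp)).symm
  rw [e1, ← fderiv_idChart_conj (h y)⁻¹ c3 (by simp), leftLog]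
  congr 2
  ext z
  congr 1
  group

omit [I.Boundaryless] in
theorem contDiffAt_leftLog (hf : ContMDiffAt 𝓘(ℝ, F) I ∞ f y) : ContDiffAt ℝ ∞ (leftLog I f) y := by
  have h1 : ContMDiffAt 𝓘(ℝ, F × F) 𝓘(ℝ, F) ∞ (Prod.fst : F × F → F) (y, y) :=
    contDiff_fst.contMDiff.contMDiffAt
  have h2 : ContMDiffAt 𝓘(ℝ, F × F) 𝓘(ℝ, F) ∞ (Prod.snd : F × F → F) (y, y) :=
    contDiff_snd.contMDiff.contMDiffAt
  have h : ContMDiffAt 𝓘(ℝ, F × F) I ∞ (fun p : F × F => (f p.1)⁻¹ * f p.2) (y, y) :=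
    (ContMDiffAt.comp (y, y) (g := f) hf h1).inv.mul (ContMDiffAt.comp (y, y) (g := f) hf h2)
  exact ContDiffAt.fderiv (f := fun y z => idChart I ((f y)⁻¹ * f z)) (g := id)
    (contDiffAt_idChart_comp (n := ⊤) h (by simp)) contDiffAt_id le_rfl

omit [I.Boundaryless] in
theorem eventually_contMDiffAt_one (hf : ContMDiffAt 𝓘(ℝ, F) I ∞ f y) :
    ∀ᶠ z in 𝓝 y, ContMDiffAt 𝓘(ℝ, F) I 1 f z :=
  have : IsManifold I 1 G := inferInstance
  (contMDiffAt_iff_contMDiffAt_nhds (by simp)).1 (hf.of_le (m := 1) (by exact_mod_cast le_top))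

theorem eventually_rightLog_eq_neg (hf : ContMDiffAt 𝓘(ℝ, F) I ∞ f y) :
    rightLog I f =ᶠ[𝓝 y] fun z => - leftLog I (fun z => (f z)⁻¹) z := by
  filter_upwards [eventually_contMDiffAt_one hf] with z hz
  exact rightLog_eq_neg hz

theorem contDiffAt_rightLog (hf : ContMDiffAt 𝓘(ℝ, F) I ∞ f y) :
    ContDiffAt ℝ ∞ (rightLog I f) y :=
  (contDiffAt_leftLog hf.inv).neg.congr_of_eventuallyEq (eventually_rightLog_eq_neg hf)

end Boundaryless

end Chart

section MaurerCartan

variable {E : Type*} [NormedAddCommGroup E] [NormedSpace ℝ E]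
  {H : Type*} [TopologicalSpace H] (I : ModelWithCorners ℝ E H)
  {G : Type*} [TopologicalSpace G] [ChartedSpace H G] [Group G]
  {F : Type*} [NormedAddCommGroup F] [NormedSpace ℝ F]

variable (G) in
/-- The left-invariant vector field with value `w` at the identity, in coordinates. -/
def invField (w : E) (a : E) : E :=
  fderiv ℝ (fun b => idChart I (idChartSymm I G a * idChartSymm I G b)) (idPt I G) w

variable [I.Boundaryless] [LieGroup I ∞ G]

theorem contDiffAt_invField (w : E) : ContDiffAt ℝ ∞ (invField I G w) (idPt I G) := by
  have hs := contMDiffAt_idChartSymm (G := G) I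
  set e := idPt I G with he
  have h1 : ContMDiffAt 𝓘(ℝ, E × E) 𝓘(ℝ, E) ∞ (Prod.fst : E × E → E) (e, e) :=
    contDiff_fst.contMDiff.contMDiffAt
  have h2 : ContMDiffAt 𝓘(ℝ, E × E) 𝓘(ℝ, E) ∞ (Prod.snd : E × E → E) (e, e) :=
    contDiff_snd.contMDiff.contMDiffAt
  have h : ContMDiffAt 𝓘(ℝ, E × E) I ∞
      (fun p : E × E => idChartSymm I G p.1 * idChartSymm I G p.2) (e, e) :=
    (ContMDiffAt.comp (e, e) (g := idChartSymm I G) hs h1).mul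
      (ContMDiffAt.comp (e, e) (g := idChartSymm I G) hs h2)
  have := ContDiffAt.fderiv (f := fun a b => idChart I (idChartSymm I G a * idChartSymm I G b))
    (g := fun _ => e) (x₀ := e) (m := ∞)
    (contDiffAt_idChart_comp (n := ⊤) h (by simp [he, idChartSymm_idPt])) contDiffAt_const le_rfl
  exact this.clm_apply contDiffAt_const

omit [I.Boundaryless] in
theorem contMDiffAt_idChart_of_mem {x : G} (hx : x ∈ (extChartAt I (1 : G)).source) :
    ContMDiffAt I 𝓘(ℝ, E) 1 (idChart I) x := by
  have : IsManifold I 1 G := inferInstance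
  rw [extChartAt_source] at hx
  exact contMDiffAt_extChartAt' hx

theorem differentiableAt_idChart_mul_idChartSymm {x : G}
    (hx : x ∈ (extChartAt I (1 : G)).source) :
    DifferentiableAt ℝ (fun b => idChart I (x * idChartSymm I G b)) (idPt I G) := by
  have hs : ContMDiffAt 𝓘(ℝ, E) I 1 (fun b => x * idChartSymm I G b) (idPt I G) :=
    contMDiffAt_const.mul ((contMDiffAt_idChartSymm (G := G) I).of_le (by exact_mod_cast le_top))
  have hk : ContMDiffAt I 𝓘(ℝ, E) 1 (idChart I) (x * idChartSymm I G (idPt I G)) := by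
    rw [idChartSymm_idPt, mul_one]; exact contMDiffAt_idChart_of_mem I hx
  exact (contMDiffAt_iff_contDiffAt.1
    (ContMDiffAt.comp (f := fun b => x * idChartSymm I G b) _ hk hs)).differentiableAt one_ne_zero

theorem tendsto_mul_idChartSymm (x : G) :
    Tendsto (fun b => x * idChartSymm I G b) (𝓝 (idPt I G)) (𝓝 x) := by
  have h : ContMDiffAt 𝓘(ℝ, E) I ∞ (fun b => x * idChartSymm I G b) (idPt I G) :=
    contMDiffAt_const.mul (contMDiffAt_idChartSymm I)
  simpa [idChartSymm_idPt] using h.continuousAt.tendsto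

theorem leftLog_invField (w : E) : ∀ᶠ a in 𝓝 (idPt I G),
    leftLog I (idChartSymm I G) a (invField I G w a) = w := by
  have hs := contMDiffAt_idChartSymm (G := G) I
  have hsrc : ∀ x ∈ (extChartAt I (1 : G)).source, ∀ᶠ x in 𝓝 x,
      x ∈ (extChartAt I (1 : G)).source := fun x hx =>
    (isOpen_extChartAt_source (1 : G)).mem_nhds hx
  have ht : ∀ᶠ a in 𝓝 (idPt I G), a ∈ (extChartAt I (1 : G)).target :=
    extChartAt_target_mem_nhds (1 : G)
  filter_upwards [eventually_contMDiffAt_one hs, ht] with a ha hta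
  have hra : idChart I (idChartSymm I G a) = a := (extChartAt I (1 : G)).right_inv hta
  have hsa : idChartSymm I G a ∈ (extChartAt I (1 : G)).source :=
    (extChartAt I (1 : G)).map_target hta
  set g := idChartSymm I G a with hg
  have hid : (fun z => idChart I (g⁻¹ * idChartSymm I G z)) ∘
      (fun b => idChart I (g * idChartSymm I G b)) =ᶠ[𝓝 (idPt I G)] id := by
    filter_upwards [(tendsto_mul_idChartSymm I g).eventually (hsrc g hsa),
      eventually_idChart_idChartSymm (G := G) I] with b hb hb'
    have : idChartSymm I G (idChart I (g * idChartSymm I G b)) = g * idChartSymm I G b :=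
      (extChartAt I (1 : G)).left_inv hb
    simp [this, hb']
  have hpt : idChart I (g * idChartSymm I G (idPt I G)) = a := by
    rw [idChartSymm_idPt, mul_one, hra]
  have hcomp := fderiv_comp (𝕜 := ℝ) (g := fun z => idChart I (g⁻¹ * idChartSymm I G z))
    (idPt I G) (by
      rw [hpt]
      exact differentiableAt_idChart_comp (P := fun z => g⁻¹ * idChartSymm I G z)
        (contMDiffAt_const.mul ha) (by simp [hg]))
    (differentiableAt_idChart_mul_idChartSymm I hsa)
  rw [hid.fderiv_eq, fderiv_id, hpt] at hcomp
  exact (DFunLike.congr_fun hcomp w).symm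

omit [LieGroup I ∞ G] in
theorem mfderiv_eq_fderiv_comp_idChartSymm {φ : G → E} (hφ : MDifferentiableAt I 𝓘(ℝ, E) φ 1) :
    mfderiv I 𝓘(ℝ, E) φ 1 = fderiv ℝ (fun b => φ (idChartSymm I G b)) (idPt I G) := by
  rw [hφ.mfderiv, I.range_eq_univ, fderivWithin_univ]
  rfl

theorem mpullbackWithin_mulInvariantVectorField (v : E) {a : E}
    (ha : a ∈ (extChartAt I (1 : G)).target) :
    mpullbackWithin 𝓘(ℝ, E) I (extChartAt I (1 : G)).symm
      (mulInvariantVectorField v) (Set.range I) a = invField I G v a := by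
  have : IsManifold I 1 G := inferInstance
  have : LieGroup I 1 G := inferInstance
  rw [mpullbackWithin_apply, ContinuousLinearMap.inverse_eq
    (mfderivWithin_extChartAt_symm_comp_mfderiv_extChartAt ha)
    (mfderiv_extChartAt_comp_mfderivWithin_extChartAt_symm ha)]
  have hsa : idChartSymm I G a ∈ (extChartAt I (1 : G)).source :=
    (extChartAt I (1 : G)).map_target ha
  set g := idChartSymm I G a with hg
  have h1 : MDifferentiableAt I I (g * ·) (1 : G) :=
    (contMDiffAt_mul_left (n := 1)).mdifferentiableAt one_ne_zero
  have h2 : MDifferentiableAt I 𝓘(ℝ, E) (extChartAt I (1 : G)) g :=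
    (contMDiffAt_idChart_of_mem I hsa).mdifferentiableAt one_ne_zero
  have h2' : MDifferentiableAt I 𝓘(ℝ, E) (extChartAt I (1 : G)) (g * 1) := by rwa [mul_one]
  have h3 := mfderiv_eq_fderiv_comp_idChartSymm I (h2'.comp (1 : G) h1)
  rw [mfderiv_comp (1 : G) h2' h1] at h3
  have h4 := DFunLike.congr_fun h3 v
  rw [mul_one] at h4
  exact h4

theorem bracket_eq_lieBracket [FiniteDimensional ℝ E] (v w : E) :
    (bracket I G v w : E) = lieBracket ℝ (invField I G v) (invField I G w) (idPt I G) := by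
  have : IsManifold I 1 G := inferInstance
  change mlieBracket I (mulInvariantVectorField v) (mulInvariantVectorField w) (1 : G) = _
  rw [← mlieBracketWithin_univ, mlieBracketWithin_apply]
  have hinv : ∀ (A : E →L[ℝ] E) (u : E), A = ContinuousLinearMap.id ℝ E → A.inverse u = u := by
    rintro A u rfl
    rw [ContinuousLinearMap.inverse_id]; rfl
  refine (hinv _ _ (mfderiv_extChartAt_self (I := I) (x := (1 : G)))).trans ?_
  rw [Set.preimage_univ, Set.univ_inter]
  have key : ∀ v : E, mpullbackWithin 𝓘(ℝ, E) I (extChartAt I (1 : G)).symm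
      (mulInvariantVectorField v) (Set.range I) =ᶠ[𝓝 (idPt I G)] invField I G v := by
    intro v
    filter_upwards [extChartAt_target_mem_nhds (I := I) (1 : G)] with a ha
    exact mpullbackWithin_mulInvariantVectorField I v ha
  refine Eq.trans ?_ ((key v).lieBracket_vectorField_eq (key w))
  rw [I.range_eq_univ]
  exact congrFun (lieBracketWithin_univ (𝕜 := ℝ) (E := E)) _

omit [LieGroup I ∞ G] in
theorem leftLog_idChartSymm_idPt :
    leftLog I (idChartSymm I G) (idPt I G) = ContinuousLinearMap.id ℝ E := by
  have : (fun z => idChart I ((idChartSymm I G (idPt I G))⁻¹ * idChartSymm I G z)) =ᶠ[𝓝 (idPt I G)]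
      id := by
    filter_upwards [eventually_idChart_idChartSymm (G := G) I] with z hz
    simp [idChartSymm_idPt, hz]
  rw [leftLog, this.fderiv_eq, fderiv_id]

variable [FiniteDimensional ℝ E]

variable (G) in
/-- The Lie bracket in coordinates. -/
def lieChart : E →ₗ[ℝ] E →ₗ[ℝ] E := bracket I G

/-- The Maurer-Cartan equation for the chart at the identity. -/
theorem fderiv_leftLog_idChartSymm (v w : E) :
    fderiv ℝ (leftLog I (idChartSymm I G)) (idPt I G) v w -
      fderiv ℝ (leftLog I (idChartSymm I G)) (idPt I G) w v = - lieChart I G v w := by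
  have hd : DifferentiableAt ℝ (leftLog I (idChartSymm I G)) (idPt I G) :=
    (contDiffAt_leftLog (contMDiffAt_idChartSymm I)).differentiableAt (by simp)
  have hv0 : ∀ w, invField I G w (idPt I G) = w := by
    intro w
    have := (leftLog_invField I (G := G) w).self_of_nhds
    rwa [leftLog_idChartSymm_idPt] at this
  have key : ∀ v w, fderiv ℝ (leftLog I (idChartSymm I G)) (idPt I G) v w +
      fderiv ℝ (invField I G w) (idPt I G) v = 0 := by
    intro v w
    have hw : DifferentiableAt ℝ (invField I G w) (idPt I G) :=
      (contDiffAt_invField I w).differentiableAt (by simp)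
    have h1 := hd.hasFDerivAt.clm_apply hw.hasFDerivAt
    have h2 := h1.unique ((hasFDerivAt_const w _).congr_of_eventuallyEq (leftLog_invField I w))
    have h3 := DFunLike.congr_fun h2 v
    simp only [leftLog_idChartSymm_idPt, hv0] at h3
    rw [add_comm]
    simpa using h3
  have hb : (lieChart I G v w : E) = _ := bracket_eq_lieBracket I v w
  rw [hb, lieBracket, hv0, hv0, eq_neg_of_add_eq_zero_left (key v w),
    eq_neg_of_add_eq_zero_left (key w v)]
  abel

variable {I}

/-- The Maurer-Cartan equation for the pullback of the left Maurer-Cartan form. -/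
theorem fderiv_leftLog_sub {f : F → G} {y : F} (hf : ContMDiffAt 𝓘(ℝ, F) I ∞ f y) (v w : F) :
    fderiv ℝ (leftLog I f) y v w - fderiv ℝ (leftLog I f) y w v =
      - lieChart I G (leftLog I f y v) (leftLog I f y w) := by
  wlog h1 : f y = 1 generalizing f
  · have := this (f := fun z => (f y)⁻¹ * f z) (contMDiffAt_const.mul hf) (by simp)
    rwa [leftLog_const_mul] at this
  set φ : F → E := fun z => idChart I (f z) with hφ
  have hφs : ContDiffAt ℝ ∞ φ y := contDiffAt_idChart_comp (n := ⊤) hf h1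
  have hφy : φ y = idPt I G := by rw [hφ]; simp only [h1]; rfl
  set θ := leftLog I (idChartSymm I G) with hθ
  have hs := contMDiffAt_idChartSymm (G := G) I
  have hφt : Tendsto φ (𝓝 y) (𝓝 (idPt I G)) := hφy ▸ hφs.continuousAt.tendsto
  have hft : Tendsto f (𝓝 y) (𝓝 1) := h1 ▸ hf.continuousAt.tendsto
  have hev : leftLog I f =ᶠ[𝓝 y] fun z => (θ (φ z)).comp (fderiv ℝ φ z) := by
    have hφd : ∀ᶠ z in 𝓝 y, ContDiffAt ℝ 1 φ z :=
      (hφs.of_le (m := 1) (by exact_mod_cast le_top)).eventually (by simp)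
    filter_upwards [eventually_contMDiffAt_one hf, hφd,
      (eventually_eventually_nhds.2 (hft.eventually (eventually_idChartSymm_idChart I))),
      hφt.eventually (eventually_contMDiffAt_one hs)] with z hz hz1 hz2 hz3
    have hsz := hz2.self_of_nhds
    have he : (fun x => idChart I ((f z)⁻¹ * f x)) =ᶠ[𝓝 z]
        (fun b => idChart I ((idChartSymm I G (φ z))⁻¹ * idChartSymm I G b)) ∘ φ := by
      filter_upwards [hz2] with x hx
      simp only [Function.comp_apply, hφ, hx, hsz]
    rw [leftLog, he.fderiv_eq, fderiv_comp _ _ (hz1.differentiableAt one_ne_zero)]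
    · rfl
    · exact differentiableAt_idChart_comp
        (P := fun b => (idChartSymm I G (φ z))⁻¹ * idChartSymm I G b)
        (contMDiffAt_const.mul hz3) (by simp)
  have hθd : DifferentiableAt ℝ θ (φ y) := by
    rw [hφy]; exact (contDiffAt_leftLog hs).differentiableAt (by simp)
  have hφ2 : DifferentiableAt ℝ (fderiv ℝ φ) y :=
    (hφs.fderiv_right (m := 1) (by
      rw [one_add_one_eq_two]; exact ENat.LEInfty.out)).differentiableAt one_ne_zero
  have hφ1 : DifferentiableAt ℝ φ y := hφs.differentiableAt (by simp)
  have hD := (hθd.hasFDerivAt.comp y hφ1.hasFDerivAt).clm_comp hφ2.hasFDerivAt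
  have hD' := hD.congr_of_eventuallyEq hev
  have hsymm : fderiv ℝ (fderiv ℝ φ) y v w = fderiv ℝ (fderiv ℝ φ) y w v :=
    (hφs.isSymmSndFDerivAt (by simpa using ENat.LEInfty.out)).eq v w
  have hθy : θ (φ y) = ContinuousLinearMap.id ℝ E := by
    rw [hφy]; exact leftLog_idChartSymm_idPt I
  have hL : leftLog I f y = fderiv ℝ φ y := by
    refine hev.self_of_nhds.trans ?_
    simp only [hθy, ContinuousLinearMap.id_comp]
  have hbase := fderiv_leftLog_idChartSymm I (G := G) (fderiv ℝ φ y v) (fderiv ℝ φ y w)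
  rw [hL, ← hbase, hD'.fderiv, hφy, ← hθ]
  simp [hsymm]

/-- The Maurer-Cartan equation for the pullback of the right Maurer-Cartan form. -/
theorem fderiv_rightLog_sub {f : F → G} {y : F} (hf : ContMDiffAt 𝓘(ℝ, F) I ∞ f y) (v w : F) :
    fderiv ℝ (rightLog I f) y v w - fderiv ℝ (rightLog I f) y w v =
      lieChart I G (rightLog I f y v) (rightLog I f y w) := by
  have hev := eventually_rightLog_eq_neg hf
  have := fderiv_leftLog_sub hf.inv v w
  rw [← neg_eq_iff_eq_neg] at this
  rw [hev.fderiv_eq, hev.self_of_nhds, fderiv_fun_neg]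
  simp only [neg_apply, map_neg, LinearMap.neg_apply, neg_neg]
  refine Eq.trans ?_ this
  change -(_ : E) - -(_ : E) = -(_ - _)
  abel

/-- The adjoint action preserves the Lie bracket. -/
theorem adChart_lieChart (a : G) (v w : E) :
    adChart I a (lieChart I G v w) = lieChart I G (adChart I a v) (adChart I a w) := by
  have hs := contMDiffAt_idChartSymm (G := G) I
  set s := idChartSymm I G with hs_def
  have hc : ContMDiffAt 𝓘(ℝ, E) I ∞ (fun z => a * s z * a⁻¹) (idPt I G) :=
    (contMDiffAt_const.mul hs).mul contMDiffAt_const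
  have hev : leftLog I (fun z => a * s z * a⁻¹) =ᶠ[𝓝 (idPt I G)]
      fun z => (adChart I a).comp (leftLog I s z) := by
    filter_upwards [eventually_contMDiffAt_one hs] with z hz
    have c : ContMDiffAt 𝓘(ℝ, E) I 1 (fun x => (s z)⁻¹ * s x) z := contMDiffAt_const.mul hz
    rw [leftLog, leftLog, ← fderiv_idChart_conj a c (by simp)]
    congr 2
    ext x
    congr 1
    group
  have hd : DifferentiableAt ℝ (leftLog I s) (idPt I G) :=
    (contDiffAt_leftLog hs).differentiableAt (by simp)
  have hD := ((hasFDerivAt_const (adChart I a) _).clm_comp hd.hasFDerivAt).congr_of_eventuallyEq hev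
  have h1 := fderiv_leftLog_sub hc v w
  have h2 := fderiv_leftLog_idChartSymm I (G := G) v w
  have h3 : leftLog I (fun z => a * s z * a⁻¹) (idPt I G) = adChart I a := by
    refine hev.self_of_nhds.trans ?_
    simp only [hs_def, leftLog_idChartSymm_idPt, ContinuousLinearMap.comp_id]
  rw [hD.fderiv, h3] at h1
  rw [← neg_inj, ← map_neg, ← h2, map_sub]
  simpa using h1

end MaurerCartan

section WedgeBilin

variable {T V W : Type*}
  [AddCommGroup T] [Module ℝ T] [TopologicalSpace T]
  [AddCommGroup V] [Module ℝ V] [TopologicalSpace V] [IsTopologicalAddGroup V]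
  [ContinuousSMul ℝ V] [T2Space V] [FiniteDimensional ℝ V]
  [AddCommGroup W] [Module ℝ W] [TopologicalSpace W] [IsTopologicalAddGroup W]
  [ContinuousSMul ℝ W]

/-- The wedge product of two linear maps regarded as 1-forms. -/
def linWedge (b : V →ₗ[ℝ] V →ₗ[ℝ] W) (α β : T →L[ℝ] V) : T [⋀^Fin 2]→L[ℝ] W :=
  wedge b (ContinuousAlternatingMap.ofSubsingleton ℝ T V (0 : Fin 1) α)
    (ContinuousAlternatingMap.ofSubsingleton ℝ T V (0 : Fin 1) β)

theorem linWedge_apply (b : V →ₗ[ℝ] V →ₗ[ℝ] W) (α β : T →L[ℝ] V) (v : Fin 2 → T) :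
    linWedge b α β v = b (α (v 0)) (β (v 1)) - b (α (v 1)) (β (v 0)) := by
  rw [linWedge, wedge_apply, Fin.sum_univ_two]
  simp [Fin.removeNth, Fin.tail, sub_eq_add_neg]

/-- The wedge product of linear maps, as a bilinear map. -/
def linWedgeBilin (b : V →ₗ[ℝ] V →ₗ[ℝ] W) :
    (T →L[ℝ] V) →ₗ[ℝ] (T →L[ℝ] V) →ₗ[ℝ] T [⋀^Fin 2]→L[ℝ] W :=
  LinearMap.mk₂ ℝ (linWedge b)
    (fun α α' β => by ext v; simp [linWedge_apply]; abel)
    (fun c α β => by ext v; simp [linWedge_apply, smul_sub])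
    (fun α β β' => by ext v; simp [linWedge_apply]; abel)
    (fun c α β => by ext v; simp [linWedge_apply, smul_sub])

/-- The cubic form `(1/6) α · [α, α]` of a linear map into a space with a product `l` and a
pairing `b`. -/
def cubicForm (b : V →ₗ[ℝ] V →ₗ[ℝ] ℝ) (l : V →ₗ[ℝ] V →ₗ[ℝ] V) (α : T →L[ℝ] V) :
    T [⋀^Fin 3]→L[ℝ] ℝ :=
  (1 / 6 : ℝ) • wedge b (ContinuousAlternatingMap.ofSubsingleton ℝ T V (0 : Fin 1) α)
    (linWedge l α α)

theorem cubicForm_apply (b : V →ₗ[ℝ] V →ₗ[ℝ] ℝ) (l : V →ₗ[ℝ] V →ₗ[ℝ] V)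
    (hskew : ∀ x y z, b x (l y z) = - b x (l z y)) (hcyc : ∀ x y z, b x (l y z) = b y (l z x))
    (α : T →L[ℝ] V) (v : Fin 3 → T) :
    cubicForm b l α v = b (α (v 0)) (l (α (v 1)) (α (v 2))) := by
  rw [cubicForm, ContinuousAlternatingMap.smul_apply, wedge_apply, Fin.sum_univ_three]
  simp only [linWedge_apply, Fin.removeNth, ContinuousAlternatingMap.ofSubsingleton_apply_apply,
    map_sub]
  have h1 := hskew (α (v 0)) (α (v 1)) (α (v 2))
  have h2 := hskew (α (v 1)) (α (v 0)) (α (v 2))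
  have h3 := hskew (α (v 2)) (α (v 0)) (α (v 1))
  have h4 := hcyc (α (v 0)) (α (v 1)) (α (v 2))
  have h5 := hcyc (α (v 1)) (α (v 2)) (α (v 0))
  simp [Fin.succAbove, Fin.lt_def]
  linarith

end WedgeBilin

section Smooth

variable {T V W : Type*}
  [NormedAddCommGroup T] [NormedSpace ℝ T] [FiniteDimensional ℝ T]
  [NormedAddCommGroup V] [NormedSpace ℝ V] [FiniteDimensional ℝ V]
  [NormedAddCommGroup W] [NormedSpace ℝ W]

theorem contDiffAt_linWedge (b : V →ₗ[ℝ] V →ₗ[ℝ] W) {n : ℕ∞ω} {α β : T → T →L[ℝ] V} {y : T}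
    (hα : ContDiffAt ℝ n α y) (hβ : ContDiffAt ℝ n β y) :
    ContDiffAt ℝ n (fun z => linWedge b (α z) (β z)) y := by
  let B : (T →L[ℝ] V) →L[ℝ] (T →L[ℝ] V) →L[ℝ] T [⋀^Fin 2]→L[ℝ] W :=
    (linWedgeBilin (T := T) b).toContinuousBilinearMap
  exact (B.contDiff.contDiffAt.comp y hα).clm_apply hβ

theorem fderiv_linWedge (b : V →ₗ[ℝ] V →ₗ[ℝ] W) {α β : T → T →L[ℝ] V} {y : T}
    (hα : DifferentiableAt ℝ α y) (hβ : DifferentiableAt ℝ β y) (x : T) :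
    fderiv ℝ (fun z => linWedge b (α z) (β z)) y x =
      linWedge b (fderiv ℝ α y x) (β y) + linWedge b (α y) (fderiv ℝ β y x) := by
  let B : (T →L[ℝ] V) →L[ℝ] (T →L[ℝ] V) →L[ℝ] T [⋀^Fin 2]→L[ℝ] W :=
    (linWedgeBilin (T := T) b).toContinuousBilinearMap
  have h : HasFDerivAt (fun z => B (α z)) (B.comp (fderiv ℝ α y)) y :=
    HasFDerivAt.comp (g := fun x => B x) y B.hasFDerivAt hα.hasFDerivAt
  have h' : HasFDerivAt (fun z => linWedge b (α z) (β z)) _ y := h.clm_apply hβ.hasFDerivAt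
  rw [h'.fderiv, add_comm]
  rfl

/-- The exterior derivative of a wedge product of 1-forms. -/
theorem extDeriv_linWedge_apply (b : V →ₗ[ℝ] V →ₗ[ℝ] W) {α β : T → T →L[ℝ] V} {y : T}
    (hα : DifferentiableAt ℝ α y) (hβ : DifferentiableAt ℝ β y) (v : Fin 3 → T) :
    extDeriv (fun z => linWedge b (α z) (β z)) y v =
      b (fderiv ℝ α y (v 0) (v 1) - fderiv ℝ α y (v 1) (v 0)) (β y (v 2))
      - b (fderiv ℝ α y (v 0) (v 2) - fderiv ℝ α y (v 2) (v 0)) (β y (v 1))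
      + b (fderiv ℝ α y (v 1) (v 2) - fderiv ℝ α y (v 2) (v 1)) (β y (v 0))
      - b (α y (v 0)) (fderiv ℝ β y (v 1) (v 2) - fderiv ℝ β y (v 2) (v 1))
      + b (α y (v 1)) (fderiv ℝ β y (v 0) (v 2) - fderiv ℝ β y (v 2) (v 0))
      - b (α y (v 2)) (fderiv ℝ β y (v 0) (v 1) - fderiv ℝ β y (v 1) (v 0)) := by
  rw [extDeriv, ContinuousAlternatingMap.alternatizeUncurryFin_apply, Fin.sum_univ_three]
  simp only [fderiv_linWedge b hα hβ, ContinuousAlternatingMap.add_apply, linWedge_apply,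
    Fin.removeNth, map_sub, LinearMap.sub_apply]
  simp [Fin.succAbove, Fin.lt_def]
  abel

end Smooth

section Invariance

variable {E : Type*} [NormedAddCommGroup E] [NormedSpace ℝ E] [FiniteDimensional ℝ E]
  {H : Type*} [TopologicalSpace H] {I : ModelWithCorners ℝ E H} [I.Boundaryless]
  {G : Type*} [TopologicalSpace G] [ChartedSpace H G] [Group G] [LieGroup I ∞ G]
  {F : Type*} [NormedAddCommGroup F] [NormedSpace ℝ F] [FiniteDimensional ℝ F]

theorem lieChart_skew (v w : E) : lieChart I G v w = - lieChart I G w v := by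
  rw [← fderiv_leftLog_idChartSymm, neg_eq_iff_eq_neg.1 (fderiv_leftLog_idChartSymm I v w).symm]
  abel

omit [FiniteDimensional ℝ E] [LieGroup I ∞ G] in
theorem adChart_one : adChart I (1 : G) = ContinuousLinearMap.id ℝ E := by
  rw [← leftLog_idChartSymm_idPt I (G := G), leftLog, idChartSymm_idPt, adChart]
  simp only [inv_one, one_mul, mul_one]

/-- The derivative at the identity of the (inverse) adjoint action is the Lie bracket. -/
theorem hasFDerivAt_adChart_inv (w : E) :
    HasFDerivAt (fun z : E => adChart I (idChartSymm I G z)⁻¹ w)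
      (LinearMap.toContinuousLinearMap (-(lieChart I G).flip w)) (idPt I G) := by
  have hs := contMDiffAt_idChartSymm (G := G) I
  set s := idChartSymm I G with hs_def
  set e := idPt I G with he
  have hs1 : s e = 1 := idChartSymm_idPt I
  let f : E × E → G := fun p => s p.1 * s p.2
  have c1 : ∀ p, ContMDiffAt 𝓘(ℝ, E × E) 𝓘(ℝ, E) ∞ (Prod.fst : E × E → E) p := fun p =>
    contDiff_fst.contMDiff.contMDiffAt
  have c2 : ∀ p, ContMDiffAt 𝓘(ℝ, E × E) 𝓘(ℝ, E) ∞ (Prod.snd : E × E → E) p := fun p =>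
    contDiff_snd.contMDiff.contMDiffAt
  have hf : ContMDiffAt 𝓘(ℝ, E × E) I ∞ f (e, e) :=
    (ContMDiffAt.comp (e, e) (g := s) hs (c1 _)).mul (ContMDiffAt.comp (e, e) (g := s) hs (c2 _))
  have hfe := eventually_contMDiffAt_one hf
  have dlog : ∀ p, ContMDiffAt 𝓘(ℝ, E × E) I 1 f p →
      DifferentiableAt ℝ (fun z => idChart I ((f p)⁻¹ * f z)) p := fun p hp =>
    differentiableAt_idChart_comp (P := fun z => (f p)⁻¹ * f z) (contMDiffAt_const.mul hp)
      (by simp)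
  have hr : ∀ᶠ z in 𝓝 e, ∀ w, leftLog I f (e, z) (w, 0) = adChart I (s z)⁻¹ w := by
    have ht : Tendsto (fun z : E => (e, z)) (𝓝 e) (𝓝 (e, e)) := by
      exact (Continuous.prodMk_right e).tendsto e
    filter_upwards [ht.eventually hfe] with z hz w
    have h := HasFDerivAt.comp (f := fun a : E => (a, z)) e (dlog _ hz).hasFDerivAt
      (hasFDerivAt_prodMk_left e z)
    have h2 : adChart I (s z)⁻¹ = _ := (h.congr_of_eventuallyEq (.of_forall fun x => by
      simp [f, hs1, mul_assoc]; rfl)).fderiv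
    rw [h2]
    rfl
  have hl : ∀ᶠ z in 𝓝 e, ∀ w, leftLog I f (z, e) (0, w) = w := by
    have ht : Tendsto (fun z : E => (z, e)) (𝓝 e) (𝓝 (e, e)) := by
      exact (Continuous.prodMk_left e).tendsto e
    filter_upwards [ht.eventually hfe] with z hz w
    have h := HasFDerivAt.comp (f := fun a : E => (z, a)) e (dlog _ hz).hasFDerivAt
      (hasFDerivAt_prodMk_right z e)
    have h1 : (fun z_1 => idChart I ((f (z, e))⁻¹ * f z_1)) ∘ (fun a => (z, a)) =ᶠ[𝓝 e] id := by
      filter_upwards [eventually_idChart_idChartSymm (G := G) I] with x hx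
      change idChart I (s x) = x at hx
      simp [f, hs1, hx]
    have h2 := h.unique ((hasFDerivAt_id e).congr_of_eventuallyEq h1)
    exact DFunLike.congr_fun h2 w
  have hd : DifferentiableAt ℝ (leftLog I f) (e, e) :=
    (contDiffAt_leftLog hf).differentiableAt (by simp)
  have hDr : HasFDerivAt (fun z : E => adChart I (s z)⁻¹ w)
      (((fderiv ℝ (leftLog I f) (e, e)).comp (ContinuousLinearMap.inr ℝ E E)).flip (w, 0)) e := by
    have h := ((HasFDerivAt.comp (f := fun a : E => (e, a)) e hd.hasFDerivAt
      (hasFDerivAt_prodMk_right e e)).clm_apply (hasFDerivAt_const ((w, 0) : E × E) e))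
    refine (h.congr_of_eventuallyEq (hr.mono fun z hz => (hz w).symm)).congr_fderiv ?_
    ext x
    simp
  refine hDr.congr_fderiv ?_
  ext x
  have hDl : fderiv ℝ (leftLog I f) (e, e) (w, 0) (0, x) = 0 := by
    have h := ((HasFDerivAt.comp (f := fun a : E => (a, e)) e hd.hasFDerivAt
      (hasFDerivAt_prodMk_left e e)).clm_apply (hasFDerivAt_const ((0, x) : E × E) e))
    have h' := h.unique ((hasFDerivAt_const x e).congr_of_eventuallyEq
      (hl.mono fun z hz => hz x))
    simpa using DFunLike.congr_fun h' w
  have hmc := fderiv_leftLog_sub hf (0, x) (w, 0)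
  have had : adChart I (s e)⁻¹ w = w := by rw [hs1, inv_one, adChart_one]; rfl
  rw [hDl, hr.self_of_nhds, hl.self_of_nhds, sub_zero, had] at hmc
  simpa using hmc

/-- The infinitesimal invariance of a pairing invariant under the adjoint action. -/
theorem pairing_lieChart_eq (b : E →ₗ[ℝ] E →ₗ[ℝ] ℝ)
    (hb : ∀ (a : G) v w, b (adChart I a v) (adChart I a w) = b v w) (x y z : E) :
    b (lieChart I G x y) z = - b y (lieChart I G x z) := by
  let b' := b.toContinuousBilinearMap
  have had : ∀ w : E, adChart I (idChartSymm I G (idPt I G))⁻¹ w = w := by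
    intro w
    rw [idChartSymm_idPt, inv_one, adChart_one]; rfl
  have h := (b'.hasFDerivAt.comp _ (hasFDerivAt_adChart_inv (I := I) (G := G) y)).clm_apply
    (hasFDerivAt_adChart_inv (I := I) (G := G) z)
  have h' := h.unique ((hasFDerivAt_const (b y z) _).congr_of_eventuallyEq
    (.of_forall fun p => hb _ y z))
  have h2 := DFunLike.congr_fun h' x
  simp [had, b', LinearMap.toContinuousBilinearMap_apply] at h2
  linarith

/-- The exterior derivative of `f^* θ · h^* (right Maurer-Cartan form)`. -/
theorem extDeriv_linWedge_leftLog_rightLog (b : E →ₗ[ℝ] E →ₗ[ℝ] ℝ) (hsymm : ∀ v w, b v w = b w v)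
    (hb : ∀ (a : G) v w, b (adChart I a v) (adChart I a w) = b v w) {f h : F → G} {y : F}
    (hf : ContMDiffAt 𝓘(ℝ, F) I ∞ f y) (hh : ContMDiffAt 𝓘(ℝ, F) I ∞ h y) :
    extDeriv (fun z => linWedge b (leftLog I f z) (rightLog I h z)) y =
      cubicForm b (lieChart I G) (leftLog I f y)
        - cubicForm b (lieChart I G) (leftLog I (fun z => f z * h z) y)
        + cubicForm b (lieChart I G) (leftLog I h y) := by
  have hskew : ∀ x y z, b x (lieChart I G y z) = - b x (lieChart I G z y) := by
    intro x y z
    rw [lieChart_skew y z, map_neg]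
  have hcyc : ∀ x y z, b x (lieChart I G y z) = b y (lieChart I G z x) := by
    intro x y z
    have h1 := pairing_lieChart_eq b hb y x z
    have h2 := pairing_lieChart_eq b hb x y z
    rw [lieChart_skew y x, map_neg, LinearMap.neg_apply] at h1
    linarith [hskew y z x]
  have le1 : (1 : ℕ∞ω) ≤ ∞ := by exact_mod_cast le_top
  ext v
  rw [extDeriv_linWedge_apply b ((contDiffAt_leftLog hf).differentiableAt (by simp))
    ((contDiffAt_rightLog hh).differentiableAt (by simp))]
  simp only [fderiv_leftLog_sub hf, fderiv_rightLog_sub hh]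
  have hAd : ∀ (a : G) x y z, b (adChart I a x) (lieChart I G (adChart I a y) (adChart I a z)) =
      b x (lieChart I G y z) := by
    intro a x y z
    rw [← adChart_lieChart, hb]
  simp only [ContinuousAlternatingMap.add_apply, ContinuousAlternatingMap.sub_apply,
    cubicForm_apply b _ hskew hcyc, leftLog_mul (hf.of_le le1) (hh.of_le le1),
    ContinuousLinearMap.comp_apply, hAd]
  rw [← hAd (h y) (leftLog I h y (v 0))]
  simp only [← ContinuousLinearMap.comp_apply, ← rightLog_eq (hh.of_le le1)]
  simp only [add_apply, map_add, map_neg, LinearMap.add_apply, LinearMap.neg_apply]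
  simp only [hsymm (lieChart I G _ _)]
  generalize leftLog I f y (v 0) = a₀
  generalize leftLog I f y (v 1) = a₁
  generalize leftLog I f y (v 2) = a₂
  generalize rightLog I h y (v 0) = b₀
  generalize rightLog I h y (v 1) = b₁
  generalize rightLog I h y (v 2) = b₂
  linarith [hcyc b₂ a₀ a₁, hcyc b₁ a₂ a₀, hskew b₁ a₂ a₀, hcyc a₀ a₁ b₂, hcyc a₁ b₂ a₀,
    hcyc b₁ a₀ a₂, hcyc a₀ a₂ b₁, hskew a₀ b₁ a₂, hcyc a₀ b₁ a₂, hcyc a₁ b₂ b₀, hskew a₁ b₂ b₀,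
    hcyc a₂ b₀ b₁, hcyc b₀ a₁ b₂, hcyc b₀ b₁ a₂, hcyc b₁ a₂ b₀, hcyc b₂ b₀ a₁]

end Invariance

section FoxCalculus

/-- The homomorphism from the integral group ring extending a function on the group. -/
def linExt {Γ A : Type*} [AddCommGroup A] (φ : Γ → A) : MonoidAlgebra ℤ Γ →+ A :=
  (Finsupp.liftAddHom fun u => zmultiplesHom A (φ u)).comp
    (MonoidAlgebra.coeffAddEquiv (R := ℤ) (M := Γ)).toAddMonoidHom

variable {Γ A : Type*} [AddCommGroup A]

theorem linExt_apply (φ : Γ → A) (z : MonoidAlgebra ℤ Γ) :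
    linExt φ z = z.coeff.sum fun u m => m • φ u := rfl

theorem linExt_single (φ : Γ → A) (u : Γ) (m : ℤ) :
    linExt φ (MonoidAlgebra.single u m) = m • φ u := by
  simp [linExt_apply]

variable [Group Γ]

theorem linExt_of (φ : Γ → A) (u : Γ) : linExt φ (MonoidAlgebra.of ℤ Γ u) = φ u := by
  rw [MonoidAlgebra.of_apply, linExt_single, one_smul]

theorem linExt_one (φ : Γ → A) : linExt φ 1 = φ 1 := by
  rw [← map_one (MonoidAlgebra.of ℤ Γ), linExt_of]

theorem linExt_mul_of (φ : Γ → A) (z : MonoidAlgebra ℤ Γ) (x : Γ) :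
    linExt φ (z * MonoidAlgebra.of ℤ Γ x) = linExt (fun u => φ (u * x)) z := by
  induction z using MonoidAlgebra.induction_linear with
  | zero => simp
  | add a b ha hb => rw [add_mul, map_add, map_add, ha, hb]
  | single u m =>
    rw [MonoidAlgebra.of_apply, MonoidAlgebra.single_mul_single, mul_one, linExt_single,
      linExt_single]

theorem linExt_of_mul_const (a : A) (u : Γ) (z : MonoidAlgebra ℤ Γ) :
    linExt (fun _ => a) (MonoidAlgebra.of ℤ Γ u * z) = linExt (fun _ => a) z := by
  induction z using MonoidAlgebra.induction_linear with
  | zero => simp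
  | add x y hx hy => rw [mul_add, map_add, map_add, hx, hy]
  | single v m =>
    rw [MonoidAlgebra.of_apply, MonoidAlgebra.single_mul_single, one_mul, linExt_single,
      linExt_single]

theorem map_prodComm {Γ' : Type*} [Group Γ'] (φ : Γ →* Γ') {g : ℕ} (h : Fin (2 * g) → Γ) :
    φ (prodComm h) = prodComm fun i => φ (h i) := by
  rw [prodComm, prodComm, map_list_prod, List.map_ofFn]
  congr 2
  ext i
  simp [map_commutatorElement]

theorem prodComm_of_comm {Γ : Type*} [CommGroup Γ] {g : ℕ} (h : Fin (2 * g) → Γ) :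
    prodComm h = 1 := by
  rw [prodComm]
  refine List.prod_eq_one fun x hx => ?_
  obtain ⟨i, rfl⟩ := (List.mem_ofFn' _ _).1 hx
  exact commutatorElement_eq_one_iff_mul_comm.2 (mul_comm _ _)

variable {α : Type*} [DecidableEq α]

theorem fox_one (i : α) : fox i (1 : FreeGroup α) = 0 := by
  rw [fox, map_one]; rfl

/-- The fundamental formula of the Fox calculus. -/
theorem sum_fox_mul [Fintype α] (u : FreeGroup α) :
    ∑ i, fox i u * (MonoidAlgebra.of ℤ _ (FreeGroup.of i) - 1) = MonoidAlgebra.of ℤ _ u - 1 := by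
  have hmul : ∀ u v : FreeGroup α,
      ∑ i, fox i (u * v) * (MonoidAlgebra.of ℤ _ (FreeGroup.of i) - 1) =
      ∑ i, fox i u * (MonoidAlgebra.of ℤ _ (FreeGroup.of i) - 1) + MonoidAlgebra.of ℤ _ u *
        ∑ i, fox i v * (MonoidAlgebra.of ℤ _ (FreeGroup.of i) - 1) := by
    intro u v
    rw [Finset.mul_sum, ← Finset.sum_add_distrib]
    refine Finset.sum_congr rfl fun i _ => ?_
    rw [fox_mul, add_mul, mul_assoc]
  induction u using FreeGroup.induction_on with
  | C1 => simp [fox_one, ← MonoidAlgebra.one_def]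
  | of j => simp only [fox_of, ite_mul, one_mul, zero_mul, Finset.sum_ite_eq, Finset.mem_univ,
      if_true]
  | inv_of j h =>
    have h1 := hmul (FreeGroup.of j)⁻¹ (FreeGroup.of j)
    rw [h, inv_mul_cancel] at h1
    simp only [fox_one, zero_mul, Finset.sum_const_zero] at h1
    rw [mul_sub, ← map_mul, inv_mul_cancel, map_one, mul_one] at h1
    rw [← sub_eq_zero, h1]
    abel
  | mul u v hu hv =>
    rw [hmul, hu, hv, mul_sub, ← map_mul, mul_one]
    abel

/-- The augmentation of the Fox derivatives, as a homomorphism. -/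
def augFox (i : α) : FreeGroup α →* Multiplicative ℤ where
  toFun u := Multiplicative.ofAdd (linExt (fun _ => 1) (fox i u))
  map_one' := by rw [fox_one, map_zero]; rfl
  map_mul' u v := by rw [fox_mul, map_add, linExt_of_mul_const, ofAdd_add]

theorem linExt_const_fox_surfaceRel {g : ℕ} (i : Fin (2 * g)) (a : A) :
    linExt (fun _ => a) (fox i (surfaceRel g)) = 0 := by
  have h : augFox i (surfaceRel g) = 1 := by
    rw [surfaceRel, map_prodComm, prodComm_of_comm]
  have h1 : linExt (fun _ => (1 : ℤ)) (fox i (surfaceRel g)) = 0 := congrArg Multiplicative.toAdd h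
  have h2 : linExt (fun _ => a) (fox i (surfaceRel g)) =
      (zmultiplesHom A a) (linExt (fun _ => (1 : ℤ)) (fox i (surfaceRel g))) := by
    simp [linExt_apply, Finsupp.sum]
  rw [h2, h1, map_zero]

theorem pairing_eq_of_boundary {g : ℕ} (L : FreeGroup (Fin (2 * g)) → A) :
    pairing (foxChain g) (fun p => L p.1 - L (p.1 * p.2) + L p.2) = L 1 - L (surfaceRel g) := by
  have hadd : ∀ (s : Finset (Fin (2 * g))) (c : Fin (2 * g) → Chain2 (FreeGroup (Fin (2 * g))))
      (ψ : _ → A), pairing (∑ i ∈ s, c i) ψ = ∑ i ∈ s, pairing (c i) ψ := by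
    intro s c ψ
    exact (Finsupp.sum_finsetSum_index (h := fun p m => m • ψ p) (fun _ => zero_smul _ _)
      (fun _ _ _ => add_smul _ _ _)).symm
  rw [foxChain, hadd]
  have hi : ∀ i : Fin (2 * g), pairing (Finsupp.mapDomain (fun u => (u, FreeGroup.of i))
      (fox i (surfaceRel g)).coeff) (fun p => L p.1 - L (p.1 * p.2) + L p.2) =
      - linExt L (fox i (surfaceRel g) * (MonoidAlgebra.of ℤ _ (FreeGroup.of i) - 1)) := by
    intro i
    have h0 := linExt_const_fox_surfaceRel i (L (FreeGroup.of i))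
    rw [pairing, Finsupp.sum_mapDomain_index
      (h := fun (p : FreeGroup (Fin (2 * g)) × FreeGroup (Fin (2 * g))) (m : ℤ) =>
        m • (L p.1 - L (p.1 * p.2) + L p.2)) (fun _ => zero_smul _ _)
      (fun _ _ _ => add_smul _ _ _), mul_sub, mul_one, map_sub, linExt_mul_of]
    rw [← add_zero (-_), ← h0]
    simp only [linExt_apply, Finsupp.sum, smul_add, smul_sub, Finset.sum_add_distrib,
      Finset.sum_sub_distrib]
    abel
  rw [Finset.sum_congr rfl fun i _ => hi i, Finset.sum_neg_distrib, ← map_sum, sum_fox_mul,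
    map_sub, linExt_of, linExt_one]
  abel

theorem evalAt_surfaceRel {g : ℕ} (h : Fin (2 * g) → Γ) :
    evalAt (surfaceRel g) h = prodComm h := by
  rw [evalAt, surfaceRel, map_prodComm]
  simp only [FreeGroup.lift_apply_of]

end FoxCalculus

section Pi

variable {E : Type*} [NormedAddCommGroup E] [NormedSpace ℝ E]
  {H : Type*} [TopologicalSpace H] {I : ModelWithCorners ℝ E H}
  {M : Type*} [TopologicalSpace M] [ChartedSpace H M] {n : ℕ}

instance boundaryless_powModel [I.Boundaryless] : (powModel I n).Boundaryless where
  range_eq_univ := by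
    rw [Set.range_eq_univ]
    intro y
    choose x hx using fun i => Set.range_eq_univ.1 I.range_eq_univ (y i)
    exact ⟨x, funext hx⟩

instance isManifold_powModel {m : ℕ∞ω} [IsManifold I m M] :
    IsManifold (powModel I n) m (Fin n → M) := by
  refine isManifold_of_contDiffOn _ _ _ ?_
  rintro _ _ ⟨e, he, rfl⟩ ⟨e', he', rfl⟩
  refine contDiffOn_pi.2 fun i => ?_
  have h : ContDiffOn ℝ m (I ∘ ((e i).symm.trans (e' i)) ∘ I.symm)
      (I.symm ⁻¹' ((e i).symm.trans (e' i)).source ∩ Set.range I) :=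
    (contDiffGroupoid m I).compatible (he i trivial) (he' i trivial) |>.1
  refine h.comp (contDiff_apply ℝ E i).contDiffOn ?_
  rintro y ⟨⟨hy1, hy2⟩, x, rfl⟩
  exact ⟨⟨hy1 i trivial, hy2 i trivial⟩, x i, rfl⟩

theorem mem_extChartAt_powModel_target {x : Fin n → M} {y : Fin n → E}
    (hy : y ∈ (extChartAt (powModel I n) x).target) (i : Fin n) :
    y i ∈ (extChartAt I (x i)).target :=
  ⟨hy.1 i trivial, hy.2 i trivial⟩

variable [I.Boundaryless]

theorem contMDiff_powModel_apply {m : ℕ∞ω} (i : Fin n) :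
    ContMDiff (powModel I n) I m (fun h : Fin n → M => h i) := by
  intro x
  rw [contMDiffAt_iff]
  refine ⟨(continuous_apply i).continuousAt, ?_⟩
  have h : ContDiffAt ℝ m (fun y : Fin n → E => y i) (extChartAt (powModel I n) x x) :=
    (contDiff_apply ℝ E i).contDiffAt
  refine (h.congr_of_eventuallyEq ?_).contDiffWithinAt
  filter_upwards [extChartAt_target_mem_nhds (I := powModel I n) x] with y hy
  exact (extChartAt I (x i)).right_inv (mem_extChartAt_powModel_target hy i)

end Pi

section Eval

variable {E : Type*} [NormedAddCommGroup E] [NormedSpace ℝ E]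
  {H : Type*} [TopologicalSpace H] (I : ModelWithCorners ℝ E H) [I.Boundaryless]
  {G : Type*} [TopologicalSpace G] [ChartedSpace H G] [Group G] [LieGroup I ∞ G] {n : ℕ}

theorem contMDiff_evalAt (u : FreeGroup (Fin n)) :
    ContMDiff (powModel I n) I ∞ (evalAt (G := G) u) := by
  induction u using FreeGroup.induction_on with
  | C1 =>
    have : (evalAt 1 : (Fin n → G) → G) = fun _ => 1 := funext fun h => map_one _
    rw [this]; exact contMDiff_const
  | of i =>
    have : (evalAt (FreeGroup.of i) : (Fin n → G) → G) = fun h => h i :=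
      funext fun h => FreeGroup.lift_apply_of
    rw [this]; exact contMDiff_powModel_apply i
  | inv_of i h =>
    have : (evalAt (FreeGroup.of i)⁻¹ : (Fin n → G) → G) =
      fun h => (evalAt (FreeGroup.of i) h)⁻¹ := funext fun h => map_inv _ _
    rw [this]; exact h.inv
  | mul u v hu hv =>
    have : (evalAt (u * v) : (Fin n → G) → G) = fun h => evalAt u h * evalAt v h :=
      funext fun h => map_mul _ _ _
    rw [this]; exact hu.mul hv

/-- Evaluation of a word on the point of `G^n` with given coordinates. -/
def evalChart (x : Fin n → G) (u : FreeGroup (Fin n)) (y : Fin n → E) : G :=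
  evalAt u ((extChartAt (powModel I n) x).symm y)

omit [I.Boundaryless] [LieGroup I ∞ G] in
theorem evalChart_mul (x : Fin n → G) (u v : FreeGroup (Fin n)) :
    evalChart I x (u * v) = fun y => evalChart I x u y * evalChart I x v y :=
  funext fun _ => map_mul _ _ _

theorem contMDiffAt_extChartAt_powModel_symm {x : Fin n → G} {y : Fin n → E}
    (hy : y ∈ (extChartAt (powModel I n) x).target) :
    ContMDiffAt 𝓘(ℝ, Fin n → E) (powModel I n) ∞ (extChartAt (powModel I n) x).symm y := by
  have : IsManifold I ∞ G := inferInstance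
  exact (contMDiffOn_extChartAt_symm x).contMDiffAt (extChartAt_target_mem_nhds' hy)

theorem contMDiffAt_evalChart (u : FreeGroup (Fin n)) {x : Fin n → G} {y : Fin n → E}
    (hy : y ∈ (extChartAt (powModel I n) x).target) :
    ContMDiffAt 𝓘(ℝ, Fin n → E) I ∞ (evalChart I x u) y :=
  (contMDiff_evalAt I u).contMDiffAt.comp y (contMDiffAt_extChartAt_powModel_symm I hy)

section Bridge

variable {F : Type*} [NormedAddCommGroup F] [NormedSpace ℝ F]

omit [I.Boundaryless] [LieGroup I ∞ G] in
theorem mfderiv_eq_fderiv_idChart {P : F → G} {y : F} (hP : MDifferentiableAt 𝓘(ℝ, F) I P y)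
    (h1 : P y = 1) (w : F) :
    (mfderiv 𝓘(ℝ, F) I P y w : E) = fderiv ℝ (fun z => idChart I (P z)) y w := by
  rw [hP.mfderiv, modelWithCornersSelf_coe, Set.range_id, fderivWithin_univ]
  have : writtenInExtChartAt 𝓘(ℝ, F) I y P = fun z => idChart I (P z) := by
    unfold writtenInExtChartAt idChart
    rw [h1]
    rfl
  rw [this]
  rfl

omit [I.Boundaryless] in
theorem leftMC_mfderiv {f : F → G} {y : F} (hf : MDifferentiableAt 𝓘(ℝ, F) I f y) (w : F) :
    (leftMC I G (f y) fun _ => mfderiv 𝓘(ℝ, F) I f y w : E) = leftLog I f y w := by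
  have : LieGroup I 1 G := inferInstance
  have hm : MDifferentiableAt I I (fun x => (f y)⁻¹ * x) (f y) :=
    (contMDiffAt_mul_left (n := 1)).mdifferentiableAt one_ne_zero
  have h := mfderiv_eq_fderiv_idChart I (hm.comp y hf) (inv_mul_cancel (f y)) w
  rw [mfderiv_comp y hm hf] at h
  exact h

omit [I.Boundaryless] in
theorem rightMC_mfderiv {f : F → G} {y : F} (hf : MDifferentiableAt 𝓘(ℝ, F) I f y) (w : F) :
    (rightMC I G (f y) fun _ => mfderiv 𝓘(ℝ, F) I f y w : E) = rightLog I f y w := by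
  have : LieGroup I 1 G := inferInstance
  have hm : MDifferentiableAt I I (fun x => x * (f y)⁻¹) (f y) :=
    (contMDiffAt_mul_right (n := 1)).mdifferentiableAt one_ne_zero
  have h := mfderiv_eq_fderiv_idChart I (hm.comp y hf) (mul_inv_cancel (f y)) w
  rw [mfderiv_comp y hm hf] at h
  exact h

theorem Ad_apply (a : G) (w : E) : (Ad I a w : E) = adChart I a w := by
  have hm : MDifferentiableAt I I (fun x : G => a * x * a⁻¹) 1 :=
    (contMDiffAt_conj a (n := 1)).mdifferentiableAt one_ne_zero
  rw [Ad, hm.mfderiv, I.range_eq_univ, fderivWithin_univ]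
  have : writtenInExtChartAt I I (1 : G) (fun x : G => a * x * a⁻¹) =
      fun b => idChart I (a * idChartSymm I G b * a⁻¹) := by
    have h1 : (fun x : G => a * x * a⁻¹) 1 = 1 := by simp
    unfold writtenInExtChartAt idChart idChartSymm
    rw [h1]
    rfl
  rw [this]
  rfl

end Bridge

theorem mfderiv_evalChart (u : FreeGroup (Fin n)) {x : Fin n → G} {y : Fin n → E}
    (hy : y ∈ (extChartAt (powModel I n) x).target) (w : Fin n → E) :
    (mfderiv (powModel I n) I (evalAt u) ((extChartAt (powModel I n) x).symm y)
      (mfderivWithin 𝓘(ℝ, Fin n → E) (powModel I n) (extChartAt (powModel I n) x).symm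
        (Set.range (powModel I n)) y w) : E) =
      mfderiv 𝓘(ℝ, Fin n → E) I (evalChart I x u) y w := by
  rw [(powModel I n).range_eq_univ, mfderivWithin_univ]
  have h := mfderiv_comp y ((contMDiff_evalAt I u).mdifferentiableAt (by simp))
    ((contMDiffAt_extChartAt_powModel_symm I hy).mdifferentiableAt (by simp))
  exact (DFunLike.congr_fun h w).symm

/-- A pairing on the Lie algebra, in coordinates. -/
def pairChart (B : LinearMap.BilinForm ℝ (GroupLieAlgebra I G)) : E →ₗ[ℝ] E →ₗ[ℝ] ℝ := B

variable [FiniteDimensional ℝ E]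

theorem localRep_evalPullback_Omega (B : LinearMap.BilinForm ℝ (GroupLieAlgebra I G))
    (p : FreeGroup (Fin n) × FreeGroup (Fin n)) {x : Fin n → G} {y : Fin n → E}
    (hy : y ∈ (extChartAt (powModel I n) x).target) :
    localRep (powModel I n) (evalPullback I (Omega I G B) p) x y =
      linWedge (pairChart I B) (leftLog I (evalChart I x p.1) y)
        (rightLog I (evalChart I x p.2) y) := by
  set q := (extChartAt (powModel I n) x).symm y with hq
  set D := mfderivWithin 𝓘(ℝ, Fin n → E) (powModel I n) (extChartAt (powModel I n) x).symm
        (Set.range (powModel I n)) y with hD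
  have h1 : MDifferentiableAt (powModel I n) I (evalAt p.1) q :=
    (contMDiff_evalAt I p.1).mdifferentiableAt (by simp)
  have h2 : MDifferentiableAt (powModel I n) I (evalAt p.2) q :=
    (contMDiff_evalAt I p.2).mdifferentiableAt (by simp)
  have hl : ∀ w : Fin n → E, (pullback (I.prod I) I Prod.fst (leftMC I G) (evalAt p.1 q,
      evalAt p.2 q) (fun _ => mfderiv (powModel I n) (I.prod I)
        (fun h => (evalAt p.1 h, evalAt p.2 h)) q (D w)) : E) = leftLog I (evalChart I x p.1) y w := by
    intro w
    rw [← leftMC_mfderiv I ((contMDiffAt_evalChart I p.1 hy).mdifferentiableAt (by simp)) w]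
    change (leftMC I G (evalAt p.1 q) fun _ => _ : E) = (leftMC I G (evalAt p.1 q) fun _ => _ : E)
    congr 1
    ext _
    rw [← mfderiv_evalChart I p.1 hy w]
    have h3 := mfderiv_comp q (mdifferentiableAt_fst (I := I) (I' := I)) (h1.prodMk h2)
    exact (DFunLike.congr_fun h3 (D w)).symm
  have hr : ∀ w : Fin n → E, (pullback (I.prod I) I Prod.snd (rightMC I G) (evalAt p.1 q,
      evalAt p.2 q) (fun _ => mfderiv (powModel I n) (I.prod I)
        (fun h => (evalAt p.1 h, evalAt p.2 h)) q (D w)) : E) = rightLog I (evalChart I x p.2) y w := by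
    intro w
    rw [← rightMC_mfderiv I ((contMDiffAt_evalChart I p.2 hy).mdifferentiableAt (by simp)) w]
    change (rightMC I G (evalAt p.2 q) fun _ => _ : E) = (rightMC I G (evalAt p.2 q) fun _ => _ : E)
    congr 1
    ext _
    rw [← mfderiv_evalChart I p.2 hy w]
    have h3 := mfderiv_comp q (mdifferentiableAt_snd (I := I) (I' := I)) (h1.prodMk h2)
    exact (DFunLike.congr_fun h3 (D w)).symm
  ext v
  refine (wedge_apply B (pullback (I.prod I) I Prod.fst (leftMC I G) (evalAt p.1 q, evalAt p.2 q))
    (pullback (I.prod I) I Prod.snd (rightMC I G) (evalAt p.1 q, evalAt p.2 q))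
    (fun i => mfderiv (powModel I n) (I.prod I) (fun h => (evalAt p.1 h, evalAt p.2 h)) q
      (D (v i)))).trans ?_
  refine Eq.trans ?_ (wedge_apply (pairChart I B) _ _ _).symm
  refine Finset.sum_congr rfl fun i _ => ?_
  refine congrArg (fun r : ℝ => (-1) ^ (i : ℕ) • r) ?_
  refine congrArg₂ (fun a b : E => pairChart I B a b) (hl (v i)) ?_
  refine Eq.trans ?_ (hr (v (i.succAbove 0)))
  refine congrArg
    (pullback (I.prod I) I Prod.snd (rightMC I G) (evalAt p.1 q, evalAt p.2 q)) ?_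
  funext j
  rw [Subsingleton.elim j 0]
  rfl

theorem localRep_pullback_lambdaForm (B : LinearMap.BilinForm ℝ (GroupLieAlgebra I G))
    (u : FreeGroup (Fin n)) {x : Fin n → G} {y : Fin n → E}
    (hy : y ∈ (extChartAt (powModel I n) x).target) :
    localRep (powModel I n) (pullback (powModel I n) I (evalAt u) (lambdaForm I G B)) x y =
      cubicForm (pairChart I B) (lieChart I G) (leftLog I (evalChart I x u) y) := by
  set q := (extChartAt (powModel I n) x).symm y with hq
  set D := mfderivWithin 𝓘(ℝ, Fin n → E) (powModel I n) (extChartAt (powModel I n) x).symm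
        (Set.range (powModel I n)) y with hD
  have hl : ∀ w : Fin n → E, (leftMC I G (evalAt u q)
      (fun _ => mfderiv (powModel I n) I (evalAt u) q (D w)) : E) =
        leftLog I (evalChart I x u) y w := by
    intro w
    rw [← leftMC_mfderiv I ((contMDiffAt_evalChart I u hy).mdifferentiableAt (by simp)) w]
    change (leftMC I G (evalAt u q) fun _ => _ : E) = (leftMC I G (evalAt u q) fun _ => _ : E)
    congr 1
    ext _
    exact mfderiv_evalChart I u hy w
  ext v
  refine (congrArg ((1 / 6 : ℝ) • ·) (wedge_apply B _ _ _)).trans ?_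
  refine Eq.trans ?_ (congrArg ((1 / 6 : ℝ) • ·) (wedge_apply (pairChart I B) _ _ _)).symm
  refine congrArg ((1 / 6 : ℝ) • ·) (Finset.sum_congr rfl fun i _ => ?_)
  refine congrArg (fun r : ℝ => (-1) ^ (i : ℕ) • r) ?_
  refine congrArg₂ (fun a b : E => pairChart I B a b) (hl (v i)) ?_
  refine (wedge_apply (bracket I G) _ _ _).trans ?_
  rw [linWedge_apply, ← hl, ← hl, Fin.sum_univ_two]
  simp only [Fin.val_zero, Fin.val_one, pow_zero, one_smul, pow_one, neg_smul, ← sub_eq_add_neg]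
  rfl

end Eval

section LocalRep

variable {E : Type*} [NormedAddCommGroup E] [NormedSpace ℝ E]
  {H : Type*} [TopologicalSpace H] (I : ModelWithCorners ℝ E H)
  {M : Type*} [TopologicalSpace M] [ChartedSpace H M] [IsManifold I 1 M]

theorem localRep_extChartAt_self {k : ℕ} (β : DForm I M ℝ k) (x : M) (v : Fin k → E) :
    localRep I β x (extChartAt I x x) v = β x v := by
  have key : ∀ (p : M), p = x → ∀ A : E →L[ℝ] TangentSpace I p, (∀ w : E, (A w : E) = w) →
      (β p).compContinuousLinearMap A v = β x v := by
    rintro p rfl A hA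
    exact congrArg (β p) (funext fun i => hA (v i))
  refine key _ (extChartAt_to_inv x) _ fun w => ?_
  exact DFunLike.congr_fun (mfderivWithin_range_extChartAt_symm (I := I) (x := x)) w

theorem extDer_apply {k : ℕ} [I.Boundaryless] (β : DForm I M ℝ k) (x : M) (v : Fin (k + 1) → E) :
    extDer I β x v = extDeriv (localRep I β x) (extChartAt I x x) v := by
  rw [← extDerivWithin_univ, ← I.range_eq_univ]
  refine congrArg (extDerivWithin (localRep I β x) (Set.range I) (extChartAt I x x))
    (funext fun i => ?_)
  exact DFunLike.congr_fun (mfderiv_extChartAt_self (I := I) (x := x)) (v i)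

omit [IsManifold I 1 M] in
theorem localRep_pairing {Γ : Type*} {k : ℕ} (c : Chain2 Γ) (φ : Γ × Γ → DForm I M ℝ k) (x : M)
    (y : E) : localRep I (pairing c φ) x y = pairing c fun p => localRep I (φ p) x y := by
  ext v
  simp only [localRep, pairing, Finsupp.sum, Finset.sum_apply, Pi.smul_apply,
    ContinuousAlternatingMap.compContinuousLinearMap_apply, ContinuousAlternatingMap.sum_apply,
    ContinuousAlternatingMap.smul_apply]

omit [IsManifold I 1 M] in
theorem extDeriv_pairing {Γ : Type*} {k : ℕ} (c : Chain2 Γ) (φ : Γ × Γ → E → E [⋀^Fin k]→L[ℝ] ℝ)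
    {y : E} (hφ : ∀ p, DifferentiableAt ℝ (φ p) y) :
    extDeriv (fun z => pairing c fun p => φ p z) y = pairing c fun p => extDeriv (φ p) y := by
  have hd : ∀ (p : Γ × Γ) (m : ℤ), DifferentiableAt ℝ (fun z => m • φ p z) y := fun p m =>
    (hφ p).const_smul m
  simp only [pairing, Finsupp.sum]
  induction c.support using Finset.cons_induction with
  | empty =>
    simp only [Finset.sum_empty]
    ext v
    rw [extDeriv_apply (differentiableAt_const _)]
    simp
  | cons a s ha ih =>
    simp only [Finset.sum_cons]
    rw [extDeriv_fun_add (hd _ _) (DifferentiableAt.fun_sum fun p _ => hd p _), ih]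
    congr 1
    simp only [← Int.cast_smul_eq_zsmul ℝ]
    exact extDeriv_fun_smul _ _

end LocalRep

section Main

variable {E : Type*} [NormedAddCommGroup E] [NormedSpace ℝ E] [FiniteDimensional ℝ E]
  {H : Type*} [TopologicalSpace H] (I : ModelWithCorners ℝ E H) [I.Boundaryless]
  {G : Type*} [TopologicalSpace G] [ChartedSpace H G] [Group G] [LieGroup I ∞ G]
  (B : LinearMap.BilinForm ℝ (GroupLieAlgebra I G)) (g : ℕ)

theorem localRep_omega {x : Fin (2 * g) → G} {y : Fin (2 * g) → E}
    (hy : y ∈ (extChartAt (powModel I (2 * g)) x).target) :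
    localRep (powModel I (2 * g)) (omega I B g) x y = pairing (foxChain g) fun p =>
      linWedge (pairChart I B) (leftLog I (evalChart I x p.1) y)
        (rightLog I (evalChart I x p.2) y) := by
  have : IsManifold I 1 G := inferInstance
  rw [omega, localRep_pairing]
  congr 1
  funext p
  exact localRep_evalPullback_Omega I B p hy

theorem contDiffAt_linWedge_evalChart (p : FreeGroup (Fin (2 * g)) × FreeGroup (Fin (2 * g)))
    {x : Fin (2 * g) → G} {y : Fin (2 * g) → E}
    (hy : y ∈ (extChartAt (powModel I (2 * g)) x).target) :
    ContDiffAt ℝ ∞ (fun y => linWedge (pairChart I B) (leftLog I (evalChart I x p.1) y)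
      (rightLog I (evalChart I x p.2) y)) y :=
  contDiffAt_linWedge _ (contDiffAt_leftLog (contMDiffAt_evalChart I p.1 hy))
    (contDiffAt_rightLog (contMDiffAt_evalChart I p.2 hy))

theorem isSmoothForm_omega : IsSmoothForm (powModel I (2 * g)) (omega I B g) := fun _ =>
  ContDiffOn.congr (fun _ hy => ContDiffAt.contDiffWithinAt (ContDiffAt.sum fun p _ =>
    (contDiffAt_linWedge_evalChart I B g p hy).const_smul _))
    fun _ hy => localRep_omega I B g hy

omit [I.Boundaryless] in
theorem cubicForm_leftLog_evalChart_one {n : ℕ} (x : Fin n → G) (y : Fin n → E) :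
    cubicForm (pairChart I B) (lieChart I G) (leftLog I (evalChart I x 1) y) = 0 := by
  have h : leftLog I (evalChart I x 1) y = 0 := by
    have : evalChart I x 1 = fun _ => 1 := funext fun _ => map_one _
    rw [this, leftLog]
    simp
  ext v
  rw [h, cubicForm, ContinuousAlternatingMap.smul_apply, wedge_apply]
  simp

variable {B}

theorem extDeriv_localRep_omega (hB : IsInvariantInner I B) {x : Fin (2 * g) → G}
    {y : Fin (2 * g) → E} (hy : y ∈ (extChartAt (powModel I (2 * g)) x).target) :
    extDeriv (localRep (powModel I (2 * g)) (omega I B g) x) y =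
      - cubicForm (pairChart I B) (lieChart I G)
        (leftLog I (evalChart I x (surfaceRel g)) y) := by
  have hb : ∀ (a : G) v w, pairChart I B (adChart I a v) (adChart I a w) = pairChart I B v w := by
    intro a v w
    rw [← Ad_apply, ← Ad_apply]
    exact hB.invariant a v w
  have hev : localRep (powModel I (2 * g)) (omega I B g) x =ᶠ[𝓝 y] fun z =>
      pairing (foxChain g) fun p => linWedge (pairChart I B) (leftLog I (evalChart I x p.1) z)
        (rightLog I (evalChart I x p.2) z) := by
    filter_upwards [extChartAt_target_mem_nhds' hy] with z hz using localRep_omega I B g hz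
  have hd : ∀ p : FreeGroup (Fin (2 * g)) × FreeGroup (Fin (2 * g)), _ := fun p =>
    extDeriv_linWedge_leftLog_rightLog (pairChart I B) hB.symm hb
      (contMDiffAt_evalChart I p.1 hy) (contMDiffAt_evalChart I p.2 hy)
  simp only [← evalChart_mul] at hd
  rw [hev.extDeriv_eq, extDeriv_pairing _ _ fun p =>
    (contDiffAt_linWedge_evalChart I B g p hy).differentiableAt (by simp)]
  simp only [hd]
  rw [pairing_eq_of_boundary fun u =>
    cubicForm (pairChart I B) (lieChart I G) (leftLog I (evalChart I x u) y),
    cubicForm_leftLog_evalChart_one, zero_sub]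

theorem extDer_omega (hB : IsInvariantInner I B) :
    extDer (powModel I (2 * g)) (omega I B g) =
      - pullback (powModel I (2 * g)) I (evalAt (surfaceRel g)) (lambdaForm I G B) := by
  have : IsManifold I 1 G := inferInstance
  funext x
  ext v
  refine (extDer_apply (powModel I (2 * g)) (omega I B g) x (v : Fin 3 → Fin (2 * g) → E)).trans ?_
  rw [extDeriv_localRep_omega I g hB (mem_extChartAt_target x),
    ← localRep_pullback_lambdaForm I B _ (mem_extChartAt_target x)]
  exact congrArg Neg.neg (localRep_extChartAt_self (powModel I (2 * g)) _ x
    (v : Fin 3 → Fin (2 * g) → E))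

end Main

end SurfaceForm

end

theorem propositionp2
    {E : Type*} [NormedAddCommGroup E] [NormedSpace ℝ E] [FiniteDimensional ℝ E]
    {H : Type*} [TopologicalSpace H] (I : ModelWithCorners ℝ E H) [I.Boundaryless]
    {G : Type*} [TopologicalSpace G] [ChartedSpace H G] [Group G] [LieGroup I ∞ G]
    [CompactSpace G] [ConnectedSpace G]
    (B : LinearMap.BilinForm ℝ (GroupLieAlgebra I G))
    (hB : SurfaceForm.IsInvariantInner I B) (g : ℕ) :
    (∀ h : Fin (2 * g) → G,
      SurfaceForm.evalAt (SurfaceForm.surfaceRel g) h = SurfaceForm.prodComm h) ∧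
    SurfaceForm.IsSmoothForm (SurfaceForm.powModel I (2 * g)) (SurfaceForm.omega I B g) ∧
    SurfaceForm.extDer (SurfaceForm.powModel I (2 * g)) (SurfaceForm.omega I B g) =
      - SurfaceForm.pullback (SurfaceForm.powModel I (2 * g)) I
          (SurfaceForm.evalAt (SurfaceForm.surfaceRel g)) (SurfaceForm.lambdaForm I G B) := by
  exact ⟨fun h => SurfaceForm.evalAt_surfaceRel h, SurfaceForm.isSmoothForm_omega I B g,
    SurfaceForm.extDer_omega I g hB⟩
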